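/- Let $X=[0,1]$ with Lebesgue measure $m$, let $\mathrm{var}(h)$ be the smallest total variation of a function in the a.e.-class of $h\in L^1(m)$, let $\|h\|_{BV}=\|h\|_1+\mathrm{var}(h)$ and $BV=\{h\in L^1(m):\|h\|_{BV}<\infty\}$. **The system.** Let $0<\delta\le 1$. Let $S$ be the left shift on $\tilde\Omega=\{1,2,\dots\}^{\mathbb Z}$ with the product measure $\mathbb Q$ of the probability vector $(Z/n^{2+\delta})_{n\ge1}$, and let $h(\omega)=\omega_0$. Let $\Omega=\{(\omega,i)\in\tilde\Omega\times\mathbb Z_{\ge 0}:\ i<h(\omega)\}$, let $\sigma(\omega,i)=(\omega,i+1)$ if $i<h(\omega)-1$ and $\sigma(\omega,i)=(S\omega,0)$ if $i=h(\omega)-1$, and let $\mathbb P(A)=\left(\int h\,d\mathbb Q\right)^{-1}\sum_{i\ge 0}\mathbb Q\{\omega:(\omega,i)\in A\}$. Let $T_0$ be the doubling map, $T_0(x)=2x$ for $x\le \frac12$ and $T_0(x)=2x-1$ for $x>\frac12$, and let $T_1(x)=\frac12\left(\lfloor 2x\rfloor+\{4x\}\right)$, where $\{\cdot\}$ is the fractional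 part. Put $T_{(\omega,i)}=T_1$ if $i<h(\omega)-1$ and $T_{(\omega,i)}=T_0$ if $i=h(\omega)-1$. For $p\in\Omega$ let $T_p^n=T_{\sigma^{n-1}p}\circ\dots\circ T_{\sigma p}\circ T_p$, let $\mathcal L_p$ be the transfer operator of $T_p$ on $L^1(m)$, given by $\int(\mathcal L_p\phi)\,g\,dm=\int\phi\,(g\circ T_p)\,dm$ for $\phi\in L^1$, $g\in L^\infty$, and let $\mathcal L_p^n=\mathcal L_{\sigma^{n-1}p}\circ\dots\circ\mathcal L_p$. Let $n_c(p)=\min\{k:T_p^k([0,\frac12])=[0,1]\}$, and let $\psi=2\cdot\mathbf 1_{[0,1/2]}-1$, $S_N\psi(p,x)=\sum_{n=0}^{N-1}\psi(T_p^n x)$. **Claim.** The following hold. 1. $\mathbb P$ is a probability measure, $\sigma$ is invertible, measure preserving and ergodic, $(p,x)\mapsto T_p(x)$ is measurable, and each $T_p$ is non-singular. 2. For every $(\omega,i)\in\Omega$ the time $n_c(\omega,i)$ is well defined and equals $h(\omega)-i$; $n_c$ is measurable and $\int n_c\,d\mathbb P=+\infty$. 3. The cocycle $(\mathcal L_p)_{p\in\Omega}$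 is good, that is: (a) $\Omega$, with its Borel sets, is a Borel subset of a complete separable metric space, $\sigma$ is a homeomorphism, and $\Omega$ is a countable union of measurable sets on each of which $p\mapsto\mathcal L_p$ is continuous for the operator norm on $BV$; (b) there is a random variable $C>0$ with $\log C\in L^1(\mathbb P)$ and, for a.e. $p$ and all $h\in BV$, $\|\mathcal L_ph\|_{BV}\le C(p)\|h\|_{BV}$; (c) there are $N\ge1$ and random variables $\alpha,K>0$ with $\int\log\alpha\,d\mathbb P<0$, $\log K\in L^1(\mathbb P)$ and, for a.e. $p$ and all $h\in BV$, $\mathrm{var}(\mathcal L_p^Nh)\le\alpha(p)\,\mathrm{var}(h)+K(p)\|h\|_1$; (d) for every $a>0$ there are an integer-valued random variable $c(p)<\infty$ and random variables $\alpha_n(p)>0$ such that, for a.e. $p$, $\operatorname{ess\,inf}\mathcal L_p^nh\ge\alpha_n(p)\|h\|_1$ for all $n\ge c(p)$ and all $h\in L^\infty$ with $h\ge0$ and $\mathrm{var}(h)\le a\|h\|_1$; (e) $\operatorname{ess\,inf}\mathcal L_p\mathbf 1>0$ a.s. and $\log\operatorname{ess\,inf}\mathcal L_p\mathbf 1\in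 L^1(\mathbb P)$. 4. Lebesgue measure is the unique equivariant family: $\mathcal L_p\mathbf 1=\mathbf 1$ for a.e. $p$, and every measurable family $(v_p)_{p\in\Omega}$ of probability densities in $BV$ with $\mathcal L_pv_p=v_{\sigma p}$ for a.e. $p$ satisfies $v_p=\mathbf 1$ for a.e. $p$. 5. The observable $\psi$, which does not depend on $p$, is measurable, lies in $BV$, and satisfies $\int\psi\,dm=0$. 6. $\psi$ violates the scaling condition: $\operatorname{ess\,sup}_pK(p)\|\psi\|_{BV}=+\infty$ for every measurable $K:\Omega\to[1,\infty)$ that is tempered ($\frac1n\log K(\sigma^np)\to0$ as $n\to\pm\infty$, for a.e. $p$) and for which there are $\lambda'>0$ and norms $\|\cdot\|_p$ $(p\in\Omega)$ on $BV$ such that, for a.e. $p$ and all $\phi\in BV$, $n\ge 0$: $\|\phi\|_{BV}\le\|\phi\|_p\le K(p)\|\phi\|_{BV}$, $\left\|\mathcal L_p^n\left(\phi-\int\phi\,dm\right)\right\|_{\sigma^np}\le e^{-\lambda'n}\|\phi\|_p$, $\left|\int\phi\,dm\right|\le\|\phi\|_p$, $\|\mathcal L_p\phi\|_{\sigma p}\le\|\phi\|_p$,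 and $\|\mathbf 1\|_p=1$. 7. For $\mathbb P$-a.e. $p$, $\displaystyle\lim_{N\to\infty}\frac1N\int_0^1\left(S_N\psi(p,x)\right)^2dm(x)=+\infty$. In particular, there is no real number $\Sigma^2$ with $\frac1N\int_0^1(S_N\psi(p,x))^2\,dm(x)\to\Sigma^2$ for $\mathbb P$-a.e. $p$. -/

import Mathlib

open MeasureTheory Filter Topology Set
open scoped ENNReal

universe u

/-! ### Functions of bounded variation on the unit interval with Lebesgue measure -/

/-- The space of Lebesgue integrable real functions on `[0,1]`, modulo null sets. -/
abbrev L1I : Type := Lp ℝ 1 (volume : Measure unitInterval)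

/-- The classical notion of variation on `L¹([0,1])`: the smallest total variation of a function
in the almost everywhere class of `f`. -/
noncomputable def essVar (f : unitInterval → ℝ) : ℝ≥0∞ :=
  ⨅ (g : unitInterval → ℝ) (_ : g =ᵐ[volume] f), eVariationOn g univ

/-- `‖f‖_BV = ‖f‖₁ + var f`. -/
noncomputable def bvNorm (f : unitInterval → ℝ) : ℝ≥0∞ := eLpNorm f 1 volume + essVar f

/-- `f ∈ BV`. -/
def MemBV (f : unitInterval → ℝ) : Prop := MemLp f 1 volume ∧ essVar f < ⊤

/-- The class in `L¹` of the constant function `1`. -/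
noncomputable def oneL1 : L1I := Lp.const 1 (volume : Measure unitInterval) (1 : ℝ)

/-! ### Random dynamical systems on the unit interval and their transfer operators -/

section Random

variable {Ω : Type u}

/-- `T_ω^n = T_{σ^{n-1} ω} ∘ ⋯ ∘ T_{σ ω} ∘ T_ω`. -/
def mapCocycle (σ : Equiv.Perm Ω) (T : Ω → unitInterval → unitInterval) : ℕ → Ω → unitInterval → unitInterval
  | 0, _ => id
  | n + 1, ω => T (σ^[n] ω) ∘ mapCocycle σ T n ω

/-- `ℒ_ω^n = ℒ_{σ^{n-1} ω} ∘ ⋯ ∘ ℒ_{σ ω} ∘ ℒ_ω`. -/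
noncomputable def opCocycle (σ : Equiv.Perm Ω) (L : Ω → L1I →L[ℝ] L1I) : ℕ → Ω → L1I →L[ℝ] L1I
  | 0, _ => ContinuousLinearMap.id ℝ L1I
  | n + 1, ω => (L (σ^[n] ω)).comp (opCocycle σ L n ω)

/-- `A` is the transfer operator of `S`, with respect to Lebesgue measure: the duality relation
`∫ (A φ) g = ∫ φ (g ∘ S)` for `φ ∈ L¹`, `g ∈ L^∞`. It determines `A`. -/
def IsTransferOperator (S : unitInterval → unitInterval) (A : L1I →L[ℝ] L1I) : Prop :=
  ∀ (φ : L1I) (g : unitInterval → ℝ), MemLp g ∞ volume → ∫ x, A φ x * g x = ∫ x, φ x * g (S x)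

/-- The cone `𝒞_a` of bounded `h ≥ 0` with `var h ≤ a ‖h‖₁`. -/
def coneBV (a : ℝ) : Set L1I :=
  {h | MemLp h ∞ volume ∧ (∀ᵐ x, 0 ≤ h x) ∧ essVar h ≤ ENNReal.ofReal (a * ‖h‖)}

/-- The Birkhoff sums `S_n ψ (ω, x) = ∑_{i < n} ψ (σ^i ω, T_ω^i x)`. -/
noncomputable def birkhoff (σ : Equiv.Perm Ω) (T : Ω → unitInterval → unitInterval) (ψ : Ω → unitInterval → ℝ)
    (n : ℕ) (ω : Ω) (x : unitInterval) : ℝ :=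
  ∑ i ∈ Finset.range n, ψ (σ^[i] ω) (mapCocycle σ T i ω x)

variable [MeasurableSpace Ω]

/-- A random family of non-singular maps of `[0,1]` over an invertible ergodic
measure-preserving transformation of a probability space. -/
structure IsRandomSystem (P : Measure Ω) (σ : Equiv.Perm Ω) (T : Ω → unitInterval → unitInterval) : Prop where
  prob : IsProbabilityMeasure P
  measurable_symm : Measurable σ.symm
  ergodic : Ergodic σ P
  measurable_map : Measurable (fun q : Ω × unitInterval => T q.1 q.2)
  nonsingular : ∀ ω, Measure.QuasiMeasurePreserving (T ω) volume volume

/-- A good cocycle of transfer operators on `BV([0,1])`. -/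
structure IsGoodCocycle [TopologicalSpace Ω] (P : Measure Ω) (σ : Equiv.Perm Ω)
    (L : Ω → L1I →L[ℝ] L1I) : Prop where
  /-- `Ω` carries its Borel sets and is a Borel subset of a Polish space. -/
  borel : BorelSpace Ω
  borel_subset : ∃ (Y : Type u) (_ : TopologicalSpace Y) (_ : PolishSpace Y)
    (_ : MeasurableSpace Y) (_ : BorelSpace Y) (e : Ω → Y), IsEmbedding e ∧ MeasurableSet (range e)
  homeo : IsHomeomorph σ
  /-- `Ω` is a countable union of measurable sets on each of which `ω ↦ ℒ_ω` is continuous for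
  the operator norm on `BV`. -/
  continuity : ∃ A : ℕ → Set Ω, (∀ k, MeasurableSet (A k)) ∧ (⋃ k, A k) = univ ∧
    ∀ k, ∀ ω ∈ A k, ∀ ε : ℝ, 0 < ε → ∀ᶠ ω' in 𝓝[A k] ω, ∀ φ : L1I, MemBV φ →
      bvNorm (L ω' φ - L ω φ : L1I) ≤ ENNReal.ofReal ε * bvNorm φ
  bounded : ∃ C : Ω → ℝ, Measurable C ∧ (∀ ω, 0 < C ω) ∧
    Integrable (fun ω => Real.log (C ω)) P ∧
    ∀ᵐ ω ∂P, ∀ h : L1I, MemBV h → bvNorm (L ω h) ≤ ENNReal.ofReal (C ω) * bvNorm h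
  lasotaYorke : ∃ (N : ℕ) (α K : Ω → ℝ), 0 < N ∧ Measurable α ∧ Measurable K ∧
    (∀ ω, 0 < α ω) ∧ (∀ ω, 0 < K ω) ∧
    Integrable (fun ω => Real.log (α ω)) P ∧ ∫ ω, Real.log (α ω) ∂P < 0 ∧
    Integrable (fun ω => Real.log (K ω)) P ∧
    ∀ᵐ ω ∂P, ∀ h : L1I, MemBV h → essVar (opCocycle σ L N ω h) ≤
      ENNReal.ofReal (α ω) * essVar h + ENNReal.ofReal (K ω * ‖h‖)
  covering : ∀ a : ℝ, 0 < a → ∃ (c : Ω → ℕ) (α : ℕ → Ω → ℝ), Measurable c ∧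
    (∀ n, Measurable (α n)) ∧ (∀ n ω, 0 < α n ω) ∧
    ∀ᵐ ω ∂P, ∀ h ∈ coneBV a, ∀ n, c ω ≤ n →
      ∀ᵐ x, α n ω * ‖h‖ ≤ opCocycle σ L n ω h x
  /-- `log (ess inf ℒ_ω 1)` is finite almost surely and integrable. -/
  essInf_pos : ∀ᵐ ω ∂P, 0 < essInf (L ω oneL1 : unitInterval → ℝ) volume
  essInf_log : Integrable (fun ω => Real.log (essInf (L ω oneL1 : unitInterval → ℝ) volume)) P

/-- The measures `v_ω dm` form a measurable equivariant family of absolutely continuous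
probability measures with densities in `BV`. -/
def IsEquivariantDensity (P : Measure Ω) (σ : Equiv.Perm Ω) (L : Ω → L1I →L[ℝ] L1I)
    (v : Ω → L1I) : Prop :=
  StronglyMeasurable v ∧ ∀ᵐ ω ∂P, MemBV (v ω) ∧ (∀ᵐ x, 0 ≤ v ω x) ∧
    ∫ x, v ω x = 1 ∧ L ω (v ω) = v (σ ω)

/-- Tempered random variables. -/
def IsTempered (P : Measure Ω) (σ : Equiv.Perm Ω) (K : Ω → ℝ) : Prop :=
  Measurable K ∧ (∀ ω, 0 < K ω) ∧ ∀ᵐ ω ∂P,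
    Tendsto (fun n : ℤ => 1 / (n : ℝ) * Real.log (K ((σ ^ n) ω))) atTop (𝓝 0) ∧
    Tendsto (fun n : ℤ => 1 / (n : ℝ) * Real.log (K ((σ ^ n) ω))) atBot (𝓝 0)

/-- `N` restricts to a norm on `BV`. -/
structure IsNormOnBV (N : L1I → ℝ) : Prop where
  nonneg : ∀ φ : L1I, MemBV φ → 0 ≤ N φ
  eq_zero : ∀ φ : L1I, MemBV φ → N φ = 0 → φ = 0
  smul : ∀ (c : ℝ) (φ : L1I), MemBV φ → N (c • φ) = |c| * N φ
  add_le : ∀ φ χ : L1I, MemBV φ → MemBV χ → N (φ + χ) ≤ N φ + N χ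

/-- `K ≥ 1` is a tempered random variable that compares the `BV` norm with a family of adapted
norms `N ω`. This is for cocycles whose equivariant measures `μ_ω` are all Lebesgue measure, so
that the cocycle of normalized transfer operators is `L` itself, and
the projection onto the functions of mean zero along the constants is `φ ↦ φ - (∫ φ) 1`. -/
def IsAdaptedConstant (P : Measure Ω) (σ : Equiv.Perm Ω) (L : Ω → L1I →L[ℝ] L1I)
    (K : Ω → ℝ) : Prop :=
  IsTempered P σ K ∧ (∀ ω, 1 ≤ K ω) ∧
  ∃ (lam : ℝ) (N : Ω → L1I → ℝ), 0 < lam ∧ (∀ ω, IsNormOnBV (N ω)) ∧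
    ∀ᵐ ω ∂P, N ω oneL1 = 1 ∧ ∀ φ : L1I, MemBV φ →
      (bvNorm φ).toReal ≤ N ω φ ∧ N ω φ ≤ K ω * (bvNorm φ).toReal ∧
      (∀ n : ℕ, N (σ^[n] ω) (opCocycle σ L n ω (φ - (∫ x, φ x) • oneL1)) ≤
        Real.exp (-lam * n) * N ω φ) ∧
      |∫ x, φ x| ≤ N ω φ ∧
      N (σ ω) (L ω φ) ≤ N ω φ

end Random

/-! ### The suspension over the full shift on `{1, 2, …}` -/

/-- All subsets of the alphabet `{1, 2, …}` are measurable. -/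
instance instMeasurableSpacePNat : MeasurableSpace ℕ+ := ⊤

instance instDiscreteMeasurableSpacePNat : DiscreteMeasurableSpace ℕ+ := ⟨fun _ => trivial⟩

/-- The sequence space `{1, 2, …}^ℤ`. -/
abbrev SymbolSeq : Type := ℤ → ℕ+

/-- The weights `1 / n^{2+δ}` before normalization. -/
noncomputable def symbolWeight (δ : ℝ) (n : ℕ+) : ℝ≥0∞ :=
  ENNReal.ofReal (1 / ((n : ℕ) : ℝ) ^ (2 + δ))

theorem tsum_symbolWeight_ne_zero (δ : ℝ) : ∑' n, symbolWeight δ n ≠ 0 := by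
  rw [ne_eq, ENNReal.tsum_eq_zero, not_forall]
  exact ⟨1, by simp [symbolWeight]⟩

theorem tsum_symbolWeight_ne_top {δ : ℝ} (hδ : 0 < δ) : ∑' n, symbolWeight δ n ≠ ⊤ := by
  have h : Summable (fun n : ℕ => 1 / (n : ℝ) ^ (2 + δ)) :=
    Real.summable_one_div_nat_rpow.2 (by linarith)
  have h' : Summable (fun n : ℕ+ => 1 / ((n : ℕ) : ℝ) ^ (2 + δ)) :=
    h.comp_injective PNat.coe_injective
  exact h'.tsum_ofReal_ne_top

/-- The probability vector `(Z / n^{2+δ})_{n ≥ 1}`. -/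
noncomputable def symbolLaw (δ : ℝ) (hδ : 0 < δ) : PMF ℕ+ :=
  PMF.normalize (symbolWeight δ) (tsum_symbolWeight_ne_zero δ) (tsum_symbolWeight_ne_top hδ)

/-- The Bernoulli measure `ℚ` on `{1, 2, …}^ℤ`. -/
noncomputable def shiftMeasure (δ : ℝ) (hδ : 0 < δ) : Measure SymbolSeq :=
  Measure.infinitePi (fun _ : ℤ => (symbolLaw δ hδ).toMeasure)

/-- `Ω = {(ω, i) : 0 ≤ i < h(ω)}` with the roof function `h(ω) = ω₀`. -/
abbrev Tower : Type := {p : SymbolSeq × ℕ // p.2 < (p.1 0 : ℕ)}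

/-- The suspension map: `(ω, i) ↦ (ω, i + 1)` if `i < h(ω) - 1`, and `(ω, i) ↦ (S ω, 0)` if
`i = h(ω) - 1`, where `S` is the left shift. -/
def towerMap : Equiv.Perm Tower where
  toFun p :=
    if h : p.1.2 + 1 < (p.1.1 0 : ℕ) then ⟨(p.1.1, p.1.2 + 1), h⟩
    else ⟨(fun n => p.1.1 (n + 1), 0), PNat.pos _⟩
  invFun p :=
    if p.1.2 = 0 then
      ⟨(fun n => p.1.1 (n - 1), (p.1.1 (0 - 1) : ℕ) - 1), Nat.sub_lt (PNat.pos _) one_pos⟩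
    else ⟨(p.1.1, p.1.2 - 1), lt_of_le_of_lt (Nat.sub_le _ _) p.2⟩
  left_inv := by
    rintro ⟨⟨ω, i⟩, hi⟩
    dsimp only at hi ⊢
    split_ifs with h1 h2 h2
    · simp at h2
    · simp
    · ext1
      simp only [sub_add_cancel, Prod.mk.injEq]
      refine ⟨trivial, ?_⟩
      omega
    · simp at h2
  right_inv := by
    rintro ⟨⟨ω, i⟩, hi⟩
    dsimp only at hi ⊢
    have hp := PNat.pos (ω (0 - 1))
    split_ifs with h1 h2 h2
    · dsimp only at h2
      omega
    · ext1
      simp [h1]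
    · ext1
      simp only [Prod.mk.injEq, true_and]
      omega
    · dsimp only at h2
      omega

/-- `P(A) = (∫ h dℚ)⁻¹ ∑_{i ≥ 0} ℚ {ω : (ω, i) ∈ A}`. -/
noncomputable def towerMeasure (δ : ℝ) (hδ : 0 < δ) : Measure Tower :=
  (∫⁻ ω, ((ω 0 : ℕ) : ℝ≥0∞) ∂(shiftMeasure δ hδ))⁻¹ •
    Measure.comap Subtype.val ((shiftMeasure δ hδ).prod Measure.count)

/-! ### The random interval map -/

/-- The doubling map of `[0,1]`. -/
noncomputable def doubling (x : unitInterval) : unitInterval :=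
  if h : (x : ℝ) ≤ 1 / 2 then ⟨2 * x, by linarith [x.2.1], by linarith⟩
  else ⟨2 * x - 1, by linarith, by linarith [x.2.2]⟩

/-- The map `T₁(x) = (E(2x) + {4x}) / 2`: a copy of the doubling map on each half of `[0,1]`. -/
noncomputable def halfDoubling (x : unitInterval) : unitInterval :=
  ⟨1 / 2 * ((⌊2 * (x : ℝ)⌋ : ℝ) + Int.fract (4 * (x : ℝ))), by
    have h1 : (0 : ℝ) ≤ (⌊2 * (x : ℝ)⌋ : ℝ) := by
      exact_mod_cast Int.floor_nonneg.2 (by linarith [x.2.1])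
    have h2 := Int.fract_nonneg (4 * (x : ℝ))
    positivity, by
    rcases eq_or_lt_of_le x.2.2 with h | h
    · rw [h]
      have e1 : ⌊2 * (1 : ℝ)⌋ = 2 := by norm_num
      have e2 : Int.fract (4 * (1 : ℝ)) = 0 := by
        have : (4 * (1 : ℝ)) = ((4 : ℤ) : ℝ) := by norm_num
        rw [this, Int.fract_intCast]
      rw [e1, e2]
      norm_num
    · have h1 : ⌊2 * (x : ℝ)⌋ < 2 := Int.floor_lt.2 (by push_cast; linarith)
      have h1' : ((⌊2 * (x : ℝ)⌋ : ℤ) : ℝ) ≤ 1 := by exact_mod_cast Int.lt_add_one_iff.1 h1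
      have h2 := Int.fract_lt_one (4 * (x : ℝ))
      linarith⟩

/-- `T_{(ω, i)} = T₁` if `i < h(ω) - 1`, and `T₀` if `i = h(ω) - 1`. -/
noncomputable def towerFamily (p : Tower) : unitInterval → unitInterval :=
  if p.1.2 + 1 < (p.1.1 0 : ℕ) then halfDoubling else doubling

/-- The set of times `k` at which `T_{(ω,i)}^k [0, 1/2] = [0, 1]`. -/
def coveringTimes (p : Tower) : Set ℕ :=
  {k | mapCocycle towerMap towerFamily k p '' {x : unitInterval | (x : ℝ) ≤ 1 / 2} = univ}

/-- The covering time `n_c`. -/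
noncomputable def coveringTime (p : Tower) : ℕ := sInf (coveringTimes p)

/-- The observable `ψ = 2 · 1_{[0,1/2]} - 1`, which does not depend on the random parameter. -/
noncomputable def obs : Tower → unitInterval → ℝ := fun _ x =>
  2 * {y : unitInterval | (y : ℝ) ≤ 1 / 2}.indicator (fun _ => (1 : ℝ)) x - 1

/-!
Both maps of the family have two inverse branches, each carrying half of Lebesgue measure
(`IsTwoBranch`). They therefore preserve Lebesgue measure, and their transfer operators are averages
over the inverse branches. The operator of the doubling map halves the variation
(`eVariationOn_doubling_le`). The operator of `halfDoubling` halves the variation on each half of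
the interval and creates one jump at `1/2`, of size at most half the total variation, so it does not
increase the variation (`eVariationOn_halfDoubling_le`). No `L¹` term appears in either estimate, so
along an orbit the variation is multiplied by `1/2` at each passage through the top of a column
(`essVar_opCocycle_le`), and every orbit passes there infinitely often. The estimates required of a
good cocycle follow: a function of small variation is uniformly close to its mean, which gives the
covering condition (`half_norm_le_opCocycle`). They also show that an equivariant density converges
to `1` along almost every orbit, and Poincaré recurrence turns this into uniqueness
(`equivariantDensity_eq_one`).

The tower is handled by integrating over columns (`lintegral_towerMeasure`). A set that is invariant
under the tower map is a union of whole columns over a shift-invariant set, and the Bernoulli shift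
is ergodic because measurable sets are approximated by cylinders, which are independent of their
distant translates (`ergodic_leftShift`). The covering time is the time left in the column, and its
sum over a column of height `h` is `h (h + 1) / 2`; it is not integrable because `∑ n^{-δ}`
diverges for `δ ≤ 1`.

The observable `ψ` is invariant under `halfDoubling`, while the doubling map decorrelates it from
the future. Along a column the cocycle fixes `ψ`, so a bounded adapted constant would contradict the
existence of arbitrarily long columns (`essSup_adaptedConstant`). The variance of the Birkhoff sums
is the sum of the squares of the lengths of the columns visited (`quenchedVariance_return`). Since
the heights have finite mean and infinite second moment, the strong law of large numbers, applied to
the heights and to their truncated squares, shows that this sum grows faster than the elapsed time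
(`ae_tendsto_quenchedVariance`).
-/

/-! ### Two-branch maps of the interval and their transfer operators -/

/-- `a` and `b` are the two inverse branches of `T`, and each of them carries one half of Lebesgue
measure: `m = (a_* m + b_* m) / 2`. -/
structure IsTwoBranch (T a b : unitInterval → unitInterval) : Prop where
  measurable : Measurable T
  measurable_left : Measurable a
  measurable_right : Measurable b
  volume_eq : (volume : Measure unitInterval) =
    (2⁻¹ : ℝ≥0∞) • Measure.map a volume + (2⁻¹ : ℝ≥0∞) • Measure.map b volume
  comp_left : T ∘ a =ᵐ[volume] id
  comp_right : T ∘ b =ᵐ[volume] id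

theorem coeFn_oneL1 : oneL1 =ᵐ[volume] fun _ => (1 : ℝ) :=
  Lp.coeFn_const (p := 1) (μ := (volume : Measure unitInterval)) (1 : ℝ)

namespace IsTwoBranch

variable {T a b : unitInterval → unitInterval}

theorem map_left_le (hT : IsTwoBranch T a b) :
    Measure.map a volume ≤ (2 : ℝ≥0∞) • (volume : Measure unitInterval) := by
  intro s
  conv_rhs => rw [hT.volume_eq]
  simp only [Measure.smul_apply, Measure.add_apply, smul_eq_mul, mul_add, ← mul_assoc]
  rw [ENNReal.mul_inv_cancel (by simp) (by simp), one_mul, one_mul]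
  exact le_self_add

theorem symm (hT : IsTwoBranch T a b) : IsTwoBranch T b a :=
  ⟨hT.measurable, hT.measurable_right, hT.measurable_left, by
    rw [add_comm]; exact hT.volume_eq, hT.comp_right, hT.comp_left⟩

theorem map_right_le (hT : IsTwoBranch T a b) :
    Measure.map b volume ≤ (2 : ℝ≥0∞) • (volume : Measure unitInterval) :=
  hT.symm.map_left_le

theorem quasi_left (hT : IsTwoBranch T a b) :
    Measure.QuasiMeasurePreserving a volume volume :=
  ⟨hT.measurable_left, Measure.absolutelyContinuous_of_le_smul hT.map_left_le⟩

theorem quasi_right (hT : IsTwoBranch T a b) :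
    Measure.QuasiMeasurePreserving b volume volume := hT.symm.quasi_left

theorem measurePreserving (hT : IsTwoBranch T a b) :
    MeasurePreserving T volume volume := by
  refine ⟨hT.measurable, ?_⟩
  conv_lhs => rw [hT.volume_eq]
  rw [Measure.map_add _ _ hT.measurable, Measure.map_smul, Measure.map_smul,
    Measure.map_map hT.measurable hT.measurable_left,
    Measure.map_map hT.measurable hT.measurable_right, Measure.map_congr hT.comp_left,
    Measure.map_congr hT.comp_right, Measure.map_id, ← add_smul, ENNReal.inv_two_add_inv_two,
    one_smul]

theorem integrable_comp_left (hT : IsTwoBranch T a b) {f : unitInterval → ℝ}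
    (hf : Integrable f) : Integrable (fun x => f (a x)) := by
  have h : Integrable f (Measure.map a volume) :=
    (hf.smul_measure (c := 2) (by simp)).mono_measure hT.map_left_le
  exact h.comp_measurable hT.measurable_left

theorem integrable_comp_right (hT : IsTwoBranch T a b) {f : unitInterval → ℝ}
    (hf : Integrable f) : Integrable (fun x => f (b x)) := hT.symm.integrable_comp_left hf

theorem integral_eq (hT : IsTwoBranch T a b) {f : unitInterval → ℝ} (hf : Integrable f) :
    ∫ x, f x = (∫ x, f (a x)) / 2 + (∫ x, f (b x)) / 2 := by
  have ha : Integrable f (Measure.map a volume) :=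
    (hf.smul_measure (c := 2) (by simp)).mono_measure hT.map_left_le
  have hb : Integrable f (Measure.map b volume) :=
    (hf.smul_measure (c := 2) (by simp)).mono_measure hT.map_right_le
  conv_lhs => rw [hT.volume_eq]
  rw [integral_add_measure (ha.smul_measure (by simp)) (hb.smul_measure (by simp)),
    integral_smul_measure, integral_smul_measure,
    integral_map hT.measurable_left.aemeasurable ha.aestronglyMeasurable,
    integral_map hT.measurable_right.aemeasurable hb.aestronglyMeasurable]
  simp only [ENNReal.toReal_inv, ENNReal.toReal_ofNat, smul_eq_mul]
  ring

theorem integrable_average (hT : IsTwoBranch T a b) {f : unitInterval → ℝ} (hf : Integrable f) :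
    Integrable (fun x => (f (a x) + f (b x)) / 2) :=
  ((hT.integrable_comp_left hf).add (hT.integrable_comp_right hf)).div_const 2

theorem average_congr (hT : IsTwoBranch T a b) {f g : unitInterval → ℝ} (h : f =ᵐ[volume] g) :
    (fun x => (f (a x) + f (b x)) / 2) =ᵐ[volume] (fun x => (g (a x) + g (b x)) / 2) := by
  filter_upwards [hT.quasi_left.ae_eq h, hT.quasi_right.ae_eq h] with x h1 h2
  simp only [Function.comp_apply] at h1 h2
  rw [h1, h2]

/-- The average over the inverse branches is a contraction of `L¹`. -/
theorem norm_average_le (hT : IsTwoBranch T a b) {f : unitInterval → ℝ} (hf : Integrable f) :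
    ∫ x, |(f (a x) + f (b x)) / 2| ≤ ∫ x, |f x| := by
  rw [hT.integral_eq hf.abs, ← add_div, ← integral_add (hT.integrable_comp_left hf.abs)
    (hT.integrable_comp_right hf.abs), ← integral_div]
  refine integral_mono (hT.integrable_average hf).abs
    (((hT.integrable_comp_left hf.abs).add (hT.integrable_comp_right hf.abs)).div_const 2) ?_
  intro x
  simp only [abs_div, abs_two]
  gcongr
  exact abs_add_le _ _

/-- The transfer operator `φ ↦ (φ ∘ a + φ ∘ b) / 2` of a two-branch map. -/
noncomputable def transfer (hT : IsTwoBranch T a b) : L1I →L[ℝ] L1I :=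
  LinearMap.mkContinuous
    { toFun := fun φ => (hT.integrable_average (L1.integrable_coeFn φ)).toL1 _
      map_add' := fun φ χ => by
        rw [← Integrable.toL1_add, Integrable.toL1_eq_toL1_iff]
        filter_upwards [hT.average_congr (Lp.coeFn_add φ χ)] with x hx
        rw [hx]
        simp only [Pi.add_apply]
        ring
      map_smul' := fun c φ => by
        rw [RingHom.id_apply, ← Integrable.toL1_smul, Integrable.toL1_eq_toL1_iff]
        filter_upwards [hT.average_congr (Lp.coeFn_smul c φ)] with x hx
        rw [hx]
        simp only [Pi.smul_apply, smul_eq_mul]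
        ring } 1 fun φ => by
    simp only [LinearMap.coe_mk, AddHom.coe_mk, one_mul]
    rw [L1.norm_eq_integral_norm, L1.norm_eq_integral_norm]
    refine le_trans (le_of_eq (integral_congr_ae ?_))
      (hT.norm_average_le (L1.integrable_coeFn φ))
    filter_upwards [Integrable.coeFn_toL1 (hT.integrable_average (L1.integrable_coeFn φ))] with x hx
    rw [hx, Real.norm_eq_abs]

theorem transfer_ae (hT : IsTwoBranch T a b) (φ : L1I) :
    hT.transfer φ =ᵐ[volume] fun x => (φ (a x) + φ (b x)) / 2 :=
  Integrable.coeFn_toL1 (hT.integrable_average (L1.integrable_coeFn φ))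

theorem transfer_ae_of_ae_eq (hT : IsTwoBranch T a b) {φ : L1I} {f : unitInterval → ℝ}
    (h : f =ᵐ[volume] φ) :
    hT.transfer φ =ᵐ[volume] fun x => (f (a x) + f (b x)) / 2 :=
  (hT.transfer_ae φ).trans (hT.average_congr h.symm)

theorem norm_transfer_le (hT : IsTwoBranch T a b) (φ : L1I) : ‖hT.transfer φ‖ ≤ ‖φ‖ := by
  have h : ‖hT.transfer‖ ≤ 1 := LinearMap.mkContinuous_norm_le _ zero_le_one _
  simpa using hT.transfer.le_of_opNorm_le h φ

theorem integral_mul_comp (hT : IsTwoBranch T a b) {f g : unitInterval → ℝ} (hf : Integrable f)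
    (hg : MemLp g ∞ volume) :
    ∫ x, f x * g (T x) = ∫ x, (f (a x) + f (b x)) / 2 * g x := by
  have hgT : MemLp (fun x => g (T x)) ∞ volume := hg.comp_measurePreserving hT.measurePreserving
  have hI : ∀ {u : unitInterval → ℝ}, Integrable u → ∀ {v : unitInterval → ℝ},
      MemLp v ∞ volume → Integrable (fun x => u x * v x) := fun hu v hv =>
    (memLp_one_iff_integrable.2 hu).integrable_mul hv
  rw [hT.integral_eq (hI hf hgT)]
  have e1 : ∫ x, f (a x) * g (T (a x)) = ∫ x, f (a x) * g x := by
    refine integral_congr_ae ?_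
    filter_upwards [hT.comp_left] with x hx
    simp only [Function.comp_apply, id_eq] at hx ⊢
    rw [hx]
  have e2 : ∫ x, f (b x) * g (T (b x)) = ∫ x, f (b x) * g x := by
    refine integral_congr_ae ?_
    filter_upwards [hT.comp_right] with x hx
    simp only [Function.comp_apply, id_eq] at hx ⊢
    rw [hx]
  rw [e1, e2, ← add_div, ← integral_add (hI (hT.integrable_comp_left hf) hg)
    (hI (hT.integrable_comp_right hf) hg), ← integral_div]
  refine integral_congr_ae (ae_of_all _ fun x => ?_)
  ring

theorem isTransferOperator (hT : IsTwoBranch T a b) : IsTransferOperator T hT.transfer := by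
  intro φ g hg
  rw [hT.integral_mul_comp (L1.integrable_coeFn φ) hg]
  refine integral_congr_ae ?_
  filter_upwards [hT.transfer_ae φ] with x hx
  rw [hx]

theorem transfer_nonneg (hT : IsTwoBranch T a b) {φ : L1I} (h : ∀ᵐ x, 0 ≤ φ x) :
    ∀ᵐ x, 0 ≤ hT.transfer φ x := by
  filter_upwards [hT.transfer_ae φ, hT.quasi_left.ae h, hT.quasi_right.ae h] with x h1 h2 h3
  rw [h1]
  positivity

theorem integral_transfer (hT : IsTwoBranch T a b) (φ : L1I) :
    ∫ x, hT.transfer φ x = ∫ x, φ x := by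
  simpa using hT.isTransferOperator φ (fun _ => 1) (memLp_const 1)

theorem transfer_one (hT : IsTwoBranch T a b) : hT.transfer oneL1 = oneL1 := by
  refine Lp.ext ((hT.transfer_ae_of_ae_eq coeFn_oneL1.symm).trans ?_)
  filter_upwards [coeFn_oneL1] with x hx
  rw [hx]
  norm_num

end IsTwoBranch

/-! ### The inverse branches of the doubling map and of its two-copy version -/

/-- The branch `x ↦ x / 2`. -/
noncomputable def leftBranch (x : unitInterval) : unitInterval :=
  ⟨(x : ℝ) / 2, by linarith [x.2.1], by linarith [x.2.2]⟩

/-- The branch `x ↦ (x + 1) / 2`. -/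
noncomputable def rightBranch (x : unitInterval) : unitInterval :=
  ⟨((x : ℝ) + 1) / 2, by linarith [x.2.1], by linarith [x.2.2]⟩

/-- The lower inverse branch of `halfDoubling`: `x ↦ x / 2` on `[0, 1/2)` and `x ↦ x / 2 + 1/4`
on `[1/2, 1]`. -/
noncomputable def lowerBranch (x : unitInterval) : unitInterval :=
  ⟨(x : ℝ) / 2 + if (x : ℝ) < 1 / 2 then 0 else 1 / 4, by split_ifs <;> linarith [x.2.1],
    by split_ifs <;> linarith [x.2.2]⟩

/-- The upper inverse branch of `halfDoubling`: the lower one shifted by `1/4`. -/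
noncomputable def upperBranch (x : unitInterval) : unitInterval :=
  ⟨(x : ℝ) / 2 + if (x : ℝ) < 1 / 2 then 1 / 4 else 1 / 2, by split_ifs <;> linarith [x.2.1],
    by split_ifs <;> linarith [x.2.2]⟩

@[simp] theorem coe_leftBranch (x : unitInterval) : (leftBranch x : ℝ) = x / 2 := rfl

@[simp] theorem coe_rightBranch (x : unitInterval) : (rightBranch x : ℝ) = (x + 1) / 2 := rfl

theorem coe_lowerBranch (x : unitInterval) :
    (lowerBranch x : ℝ) = x / 2 + if (x : ℝ) < 1 / 2 then 0 else 1 / 4 := rfl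

theorem coe_upperBranch (x : unitInterval) :
    (upperBranch x : ℝ) = x / 2 + if (x : ℝ) < 1 / 2 then 1 / 4 else 1 / 2 := rfl

theorem measurable_leftBranch : Measurable leftBranch :=
  (measurable_subtype_coe.div_const 2).subtype_mk

theorem measurable_rightBranch : Measurable rightBranch :=
  ((measurable_subtype_coe.add_const 1).div_const 2).subtype_mk

theorem measurableSet_coe_lt (c : ℝ) : MeasurableSet {x : unitInterval | (x : ℝ) < c} :=
  measurableSet_lt measurable_subtype_coe measurable_const

theorem measurableSet_coe_le (c : ℝ) : MeasurableSet {x : unitInterval | (x : ℝ) ≤ c} :=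
  measurableSet_le measurable_subtype_coe measurable_const

theorem measurable_lowerBranch : Measurable lowerBranch :=
  ((measurable_subtype_coe.div_const 2).add
    (Measurable.ite (measurableSet_coe_lt _) measurable_const measurable_const)).subtype_mk

theorem measurable_upperBranch : Measurable upperBranch :=
  ((measurable_subtype_coe.div_const 2).add
    (Measurable.ite (measurableSet_coe_lt _) measurable_const measurable_const)).subtype_mk

theorem coe_doubling (x : unitInterval) :
    (doubling x : ℝ) = if (x : ℝ) ≤ 1 / 2 then 2 * (x : ℝ) else 2 * x - 1 := by
  unfold doubling
  split_ifs <;> rfl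

theorem coe_halfDoubling (x : unitInterval) :
    (halfDoubling x : ℝ) = 1 / 2 * ((⌊2 * (x : ℝ)⌋ : ℝ) + Int.fract (4 * (x : ℝ))) := rfl

theorem measurable_doubling : Measurable doubling := by
  refine unitInterval.measurableEmbedding_coe.measurable_comp_iff.1 ?_
  simp only [Function.comp_def, coe_doubling]
  exact Measurable.ite (measurableSet_coe_le _) (measurable_subtype_coe.const_mul 2)
    ((measurable_subtype_coe.const_mul 2).sub_const 1)

theorem measurable_halfDoubling : Measurable halfDoubling := by
  unfold halfDoubling
  refine Measurable.subtype_mk ?_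
  fun_prop

theorem volume_eq_branches : (volume : Measure unitInterval) =
    (2⁻¹ : ℝ≥0∞) • Measure.map leftBranch volume +
      (2⁻¹ : ℝ≥0∞) • Measure.map rightBranch volume := by
  have hh : ∀ t : ℝ, 2⁻¹ * ENNReal.ofReal t = ENNReal.ofReal (t / 2) := fun t => by
    rw [div_eq_inv_mul, ENNReal.ofReal_mul (by norm_num), ENNReal.ofReal_inv_of_pos two_pos]
    simp
  refine Measure.ext_of_Iic _ _ fun x => ?_
  have hx0 := x.2.1
  have hx1 := x.2.2
  simp only [Measure.add_apply, Measure.smul_apply, smul_eq_mul,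
    Measure.map_apply measurable_leftBranch measurableSet_Iic,
    Measure.map_apply measurable_rightBranch measurableSet_Iic, unitInterval.volume_Iic]
  rcases lt_or_ge (x : ℝ) (1 / 2) with h | h
  · have e1 : leftBranch ⁻¹' Iic x = Iic ⟨2 * x, by linarith, by linarith⟩ := by
      ext y
      simp only [mem_preimage, mem_Iic, ← Subtype.coe_le_coe, coe_leftBranch]
      constructor <;> intro <;> linarith
    have e2 : rightBranch ⁻¹' Iic x = ∅ := by
      ext y
      simp only [mem_preimage, mem_Iic, ← Subtype.coe_le_coe, coe_rightBranch, mem_empty_iff_false,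
        iff_false, not_le]
      linarith [y.2.1]
    rw [e1, e2, measure_empty, mul_zero, add_zero, unitInterval.volume_Iic, hh]
    congr 1
    dsimp only
    ring
  · have e1 : leftBranch ⁻¹' Iic x = univ := by
      ext y
      simp only [mem_preimage, mem_Iic, ← Subtype.coe_le_coe, coe_leftBranch, mem_univ, iff_true]
      linarith [y.2.2]
    have e2 : rightBranch ⁻¹' Iic x = Iic ⟨2 * x - 1, by linarith, by linarith⟩ := by
      ext y
      simp only [mem_preimage, mem_Iic, ← Subtype.coe_le_coe, coe_rightBranch]
      constructor <;> intro <;> linarith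
    rw [e1, e2, measure_univ, unitInterval.volume_Iic, hh, ← ENNReal.ofReal_one, hh,
      ← ENNReal.ofReal_add (by norm_num) (by dsimp only; linarith)]
    congr 1
    dsimp only
    ring

theorem ae_ne_point (c : unitInterval) : ∀ᵐ x : unitInterval, x ≠ c := by
  rw [ae_iff]
  simp

theorem ae_coe_ne (c : ℝ) : ∀ᵐ x : unitInterval, (x : ℝ) ≠ c := by
  by_cases hc : c ∈ unitInterval
  · filter_upwards [ae_ne_point ⟨c, hc⟩] with x hx h
    exact hx (Subtype.ext h)
  · exact ae_of_all _ fun x h => hc (h ▸ x.2)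

theorem isTwoBranch_doubling : IsTwoBranch doubling leftBranch rightBranch where
  measurable := measurable_doubling
  measurable_left := measurable_leftBranch
  measurable_right := measurable_rightBranch
  volume_eq := volume_eq_branches
  comp_left := ae_of_all _ fun x => by
    ext
    have := x.2.2
    simp only [Function.comp_apply, coe_doubling, id_eq]
    split_ifs with h <;> simp only [coe_leftBranch] at h ⊢ <;> linarith
  comp_right := by
    filter_upwards [ae_coe_ne 0] with x hx
    ext
    have : 0 < (x : ℝ) := lt_of_le_of_ne x.2.1 (Ne.symm hx)
    simp only [Function.comp_apply, coe_doubling, id_eq]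
    split_ifs with h <;> simp only [coe_rightBranch] at h ⊢ <;> linarith

/-- The inverse branches of `halfDoubling` are those of the doubling map conjugated into the two
halves of the interval, so the four words of length two in `leftBranch`, `rightBranch` give the
required decomposition of Lebesgue measure. -/
theorem volume_eq_half_branches : (volume : Measure unitInterval) =
    (2⁻¹ : ℝ≥0∞) • Measure.map lowerBranch volume +
      (2⁻¹ : ℝ≥0∞) • Measure.map upperBranch volume := by
  have hl := measurable_leftBranch
  have hr := measurable_rightBranch
  have split : ∀ f : unitInterval → unitInterval, Measurable f → Measure.map f volume =
      (2⁻¹ : ℝ≥0∞) • Measure.map (f ∘ leftBranch) volume +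
        (2⁻¹ : ℝ≥0∞) • Measure.map (f ∘ rightBranch) volume := fun f hf => by
    conv_lhs => rw [volume_eq_branches]
    rw [Measure.map_add _ _ hf, Measure.map_smul, Measure.map_smul, Measure.map_map hf hl,
      Measure.map_map hf hr]
  have e1 : lowerBranch ∘ leftBranch =ᵐ[volume] leftBranch ∘ leftBranch := by
    filter_upwards [ae_coe_ne 1] with x hx
    have : (x : ℝ) < 1 := lt_of_le_of_ne x.2.2 hx
    ext
    simp only [Function.comp_apply, coe_lowerBranch]
    split_ifs with h <;> simp only [coe_leftBranch] at h ⊢ <;> linarith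
  have e2 : upperBranch ∘ leftBranch =ᵐ[volume] leftBranch ∘ rightBranch := by
    filter_upwards [ae_coe_ne 1] with x hx
    have : (x : ℝ) < 1 := lt_of_le_of_ne x.2.2 hx
    ext
    simp only [Function.comp_apply, coe_upperBranch]
    split_ifs with h <;> simp only [coe_leftBranch, coe_rightBranch] at h ⊢ <;> linarith
  have e3 : lowerBranch ∘ rightBranch = rightBranch ∘ leftBranch := by
    ext x
    have := x.2.1
    simp only [Function.comp_apply, coe_lowerBranch]
    split_ifs with h <;> simp only [coe_leftBranch, coe_rightBranch] at h ⊢ <;> linarith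
  have e4 : upperBranch ∘ rightBranch = rightBranch ∘ rightBranch := by
    ext x
    have := x.2.1
    simp only [Function.comp_apply, coe_upperBranch]
    split_ifs with h <;> simp only [coe_rightBranch] at h ⊢ <;> linarith
  rw [split _ measurable_lowerBranch, split _ measurable_upperBranch, Measure.map_congr e1,
    Measure.map_congr e2, e3, e4]
  conv_lhs => rw [volume_eq_branches, split _ hl, split _ hr]
  simp only [smul_add]
  abel

theorem isTwoBranch_halfDoubling : IsTwoBranch halfDoubling lowerBranch upperBranch where
  measurable := measurable_halfDoubling
  measurable_left := measurable_lowerBranch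
  measurable_right := measurable_upperBranch
  volume_eq := volume_eq_half_branches
  comp_left := by
    filter_upwards [ae_coe_ne 1] with x hx
    have h0 := x.2.1
    have h1 : (x : ℝ) < 1 := lt_of_le_of_ne x.2.2 hx
    ext
    simp only [Function.comp_apply, coe_halfDoubling, coe_lowerBranch, id_eq]
    split_ifs with h
    · have e1 : ⌊2 * ((x : ℝ) / 2 + 0)⌋ = 0 := Int.floor_eq_iff.2 ⟨by push_cast; linarith,
        by push_cast; linarith⟩
      have e2 : Int.fract (4 * ((x : ℝ) / 2 + 0)) = 2 * x :=
        Int.fract_eq_iff.2 ⟨by linarith, by linarith, 0, by push_cast; ring⟩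
      rw [e1, e2]
      push_cast
      ring
    · have e1 : ⌊2 * ((x : ℝ) / 2 + 1 / 4)⌋ = 1 := Int.floor_eq_iff.2 ⟨by push_cast; linarith,
        by push_cast; linarith⟩
      have e2 : Int.fract (4 * ((x : ℝ) / 2 + 1 / 4)) = 2 * x - 1 :=
        Int.fract_eq_iff.2 ⟨by linarith, by linarith, 2, by push_cast; ring⟩
      rw [e1, e2]
      push_cast
      ring
  comp_right := by
    filter_upwards [ae_coe_ne 1] with x hx
    have h0 := x.2.1
    have h1 : (x : ℝ) < 1 := lt_of_le_of_ne x.2.2 hx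
    ext
    simp only [Function.comp_apply, coe_halfDoubling, coe_upperBranch, id_eq]
    split_ifs with h
    · have e1 : ⌊2 * ((x : ℝ) / 2 + 1 / 4)⌋ = 0 := Int.floor_eq_iff.2 ⟨by push_cast; linarith,
        by push_cast; linarith⟩
      have e2 : Int.fract (4 * ((x : ℝ) / 2 + 1 / 4)) = 2 * x :=
        Int.fract_eq_iff.2 ⟨by linarith, by linarith, 1, by push_cast; ring⟩
      rw [e1, e2]
      push_cast
      ring
    · have e1 : ⌊2 * ((x : ℝ) / 2 + 1 / 2)⌋ = 1 := Int.floor_eq_iff.2 ⟨by push_cast; linarith,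
        by push_cast; linarith⟩
      have e2 : Int.fract (4 * ((x : ℝ) / 2 + 1 / 2)) = 2 * x - 1 :=
        Int.fract_eq_iff.2 ⟨by linarith, by linarith, 3, by push_cast; ring⟩
      rw [e1, e2]
      push_cast
      ring

/-! ### Variation under the transfer operators -/

theorem edist_average_le (a b c d : ℝ) :
    edist ((a + b) / 2) ((c + d) / 2) ≤ 2⁻¹ * (edist a c + edist b d) := by
  have h2 : (2⁻¹ : ℝ≥0∞) = ENNReal.ofReal 2⁻¹ := by
    rw [ENNReal.ofReal_inv_of_pos two_pos]; simp
  rw [edist_dist, edist_dist, edist_dist, Real.dist_eq, Real.dist_eq, Real.dist_eq,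
    ← ENNReal.ofReal_add (abs_nonneg _) (abs_nonneg _), h2, ← ENNReal.ofReal_mul (by norm_num)]
  refine ENNReal.ofReal_le_ofReal ?_
  have h : (a + b) / 2 - (c + d) / 2 = 2⁻¹ * ((a - c) + (b - d)) := by ring
  rw [h, abs_mul, abs_of_pos (by norm_num : (0 : ℝ) < 2⁻¹)]
  gcongr
  exact abs_add_le _ _

theorem eVariationOn_average_le {α : Type*} [LinearOrder α] (f g : α → ℝ) (s : Set α) :
    eVariationOn (fun x => (f x + g x) / 2) s ≤
      2⁻¹ * (eVariationOn f s + eVariationOn g s) := by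
  refine iSup_le fun ⟨n, u, hu, us⟩ => ?_
  calc ∑ i ∈ Finset.range n, edist ((f (u (i + 1)) + g (u (i + 1))) / 2)
        ((f (u i) + g (u i)) / 2)
      ≤ ∑ i ∈ Finset.range n, 2⁻¹ * (edist (f (u (i + 1))) (f (u i)) +
          edist (g (u (i + 1))) (g (u i))) := Finset.sum_le_sum fun i _ => edist_average_le _ _ _ _
    _ = 2⁻¹ * (∑ i ∈ Finset.range n, edist (f (u (i + 1))) (f (u i)) +
          ∑ i ∈ Finset.range n, edist (g (u (i + 1))) (g (u i))) := by
        rw [← Finset.mul_sum, Finset.sum_add_distrib]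
    _ ≤ _ := by
        gcongr
        · exact eVariationOn.sum_le hu us
        · exact eVariationOn.sum_le hu us

/-- Changing a function at the last point of a set changes its variation by at most the size of
the change. -/
theorem eVariationOn_le_add_edist {α : Type*} [LinearOrder α] {f g : α → ℝ} {s : Set α} {a : α}
    (ha : IsGreatest s a) (h : ∀ x ∈ s, x ≠ a → f x = g x) :
    eVariationOn f s ≤ eVariationOn g s + edist (f a) (g a) := by
  classical
  refine iSup_le fun ⟨n, u, hu, us⟩ => ?_
  -- `f - g` lives at `a`, and a monotone sequence that has reached `a` stays there
  set d : ℕ → ℝ := fun i => if u i = a then 1 else 0 with hd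
  have hdm : Monotone d := by
    intro i j hij
    simp only [hd]
    split_ifs with h1 h2
    · exact le_rfl
    · exact absurd (le_antisymm (ha.2 (us j)) (h1 ▸ hu hij)) h2
    · exact zero_le_one
    · exact le_rfl
  have key : ∀ i, edist (f (u (i + 1))) (f (u i)) ≤ edist (g (u (i + 1))) (g (u i)) +
      edist (f a) (g a) * ENNReal.ofReal (d (i + 1) - d i) := by
    intro i
    by_cases h1 : u i = a
    · have h2 : u (i + 1) = a := le_antisymm (ha.2 (us _)) (h1 ▸ hu (Nat.le_succ i))
      simp [h1, h2]
    · by_cases h2 : u (i + 1) = a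
      · simp only [hd, h2, h1, if_true, if_false, sub_zero, ENNReal.ofReal_one, mul_one,
          h _ (us i) h1]
        rw [add_comm]
        exact edist_triangle _ _ _
      · simp [h _ (us i) h1, h _ (us (i + 1)) h2]
  calc ∑ i ∈ Finset.range n, edist (f (u (i + 1))) (f (u i))
      ≤ ∑ i ∈ Finset.range n, edist (g (u (i + 1))) (g (u i)) +
        edist (f a) (g a) * ENNReal.ofReal (d n - d 0) := by
        refine (Finset.sum_le_sum fun i _ => key i).trans (le_of_eq ?_)
        rw [Finset.sum_add_distrib, ← Finset.mul_sum, ← ENNReal.ofReal_sum_of_nonneg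
          (fun i _ => sub_nonneg.2 (hdm (Nat.le_succ i))), Finset.sum_range_sub]
    _ ≤ eVariationOn g s + edist (f a) (g a) * 1 := by
        gcongr
        · exact eVariationOn.sum_le hu us
        · rw [ENNReal.ofReal_le_one]
          simp only [hd]
          split_ifs <;> norm_num
    _ = _ := by rw [mul_one]

/-- The midpoint of the unit interval. -/
noncomputable def midpointI : unitInterval := ⟨1 / 2, by norm_num, by norm_num⟩

@[simp] theorem coe_midpointI : (midpointI : ℝ) = 1 / 2 := rfl

/-- If two monotone branches send `s` to consecutive pieces of `v`, then the average of `g` over the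
branches has on `s` at most half the variation of `g` on `v`. -/
theorem eVariationOn_pieces_le {f g : unitInterval → ℝ} {φ χ : unitInterval → unitInterval}
    {s t u v : Set unitInterval} (hφ : MonotoneOn φ s) (hχ : MonotoneOn χ s)
    (hφs : MapsTo φ s t) (hχs : MapsTo χ s u) (htu : ∀ x ∈ t, ∀ y ∈ u, x ≤ y) (hv : t ∪ u ⊆ v)
    (hf : ∀ x, f x = (g (φ x) + g (χ x)) / 2) :
    eVariationOn f s ≤ 2⁻¹ * eVariationOn g v := by
  obtain rfl : f = fun x => ((g ∘ φ) x + (g ∘ χ) x) / 2 := funext hf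
  refine (eVariationOn_average_le _ _ _).trans ?_
  gcongr
  calc eVariationOn (g ∘ φ) s + eVariationOn (g ∘ χ) s
      ≤ eVariationOn g t + eVariationOn g u := add_le_add
        (eVariationOn.comp_le_of_monotoneOn g φ hφ hφs)
        (eVariationOn.comp_le_of_monotoneOn g χ hχ hχs)
    _ ≤ eVariationOn g (t ∪ u) := eVariationOn.add_le_union g htu
    _ ≤ eVariationOn g v := eVariationOn.mono g hv

theorem eVariationOn_doubling_le (g : unitInterval → ℝ) :
    eVariationOn (fun x => (g (leftBranch x) + g (rightBranch x)) / 2) univ ≤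
      2⁻¹ * eVariationOn g univ := by
  refine eVariationOn_pieces_le (φ := leftBranch) (χ := rightBranch) (t := Iic midpointI)
    (u := Ici midpointI) ?_ ?_ ?_ ?_ (fun x hx y hy => le_trans hx hy) (subset_univ _)
    fun x => rfl
  · intro x _ y _ h
    rw [← Subtype.coe_le_coe] at h ⊢
    simp only [coe_leftBranch]
    linarith
  · intro x _ y _ h
    rw [← Subtype.coe_le_coe] at h ⊢
    simp only [coe_rightBranch]
    linarith
  · intro x _
    rw [mem_Iic, ← Subtype.coe_le_coe, coe_leftBranch, coe_midpointI]
    linarith [x.2.2]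
  · intro x _
    rw [mem_Ici, ← Subtype.coe_le_coe, coe_rightBranch, coe_midpointI]
    linarith [x.2.1]

/-- On each half of the interval the variation is halved, and the jump at `1/2` that the two halves
create is half the increment of `g` between `1/4` and `3/4`. -/
theorem eVariationOn_halfDoubling_le (g : unitInterval → ℝ) :
    eVariationOn (fun x => (g (lowerBranch x) + g (upperBranch x)) / 2) univ ≤
      eVariationOn g univ := by
  set G : unitInterval → ℝ := fun x => (g (lowerBranch x) + g (upperBranch x)) / 2 with hG
  -- the continuous extension of the upper branch over the left half of the interval
  let χ : unitInterval → unitInterval := fun x =>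
    ⟨(x : ℝ) / 2 + 1 / 4, by linarith [x.2.1], by linarith [x.2.2]⟩
  have hχ : ∀ x, (χ x : ℝ) = (x : ℝ) / 2 + 1 / 4 := fun x => rfl
  set G₀ : unitInterval → ℝ := fun x => (g (leftBranch x) + g (χ x)) / 2 with hG₀
  let q : unitInterval := ⟨1 / 4, by norm_num, by norm_num⟩
  let r : unitInterval := ⟨3 / 4, by norm_num, by norm_num⟩
  have hq : (q : ℝ) = 1 / 4 := rfl
  have hr : (r : ℝ) = 3 / 4 := rfl
  have hleft : eVariationOn G₀ (Iic midpointI) ≤ 2⁻¹ * eVariationOn g (Iic midpointI) := by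
    refine eVariationOn_pieces_le (φ := leftBranch) (χ := χ) (t := Iic q)
      (u := Icc q midpointI) ?_ ?_ ?_ ?_ (fun x hx y hy => le_trans hx hy.1) ?_ fun x => rfl
    · intro x _ y _ h
      rw [← Subtype.coe_le_coe] at h ⊢
      simp only [coe_leftBranch]
      linarith
    · intro x _ y _ h
      rw [← Subtype.coe_le_coe] at h ⊢
      rw [hχ, hχ]
      linarith
    · intro x hx
      rw [mem_Iic, ← Subtype.coe_le_coe, coe_midpointI] at hx
      rw [mem_Iic, ← Subtype.coe_le_coe, coe_leftBranch, hq]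
      linarith
    · intro x hx
      rw [mem_Iic, ← Subtype.coe_le_coe, coe_midpointI] at hx
      rw [mem_Icc, ← Subtype.coe_le_coe, ← Subtype.coe_le_coe, hχ, hq, coe_midpointI]
      exact ⟨by linarith [x.2.1], by linarith⟩
    · refine union_subset (Iic_subset_Iic.2 ?_) fun x hx => hx.2
      rw [← Subtype.coe_le_coe, hq, coe_midpointI]
      norm_num
  have hright : eVariationOn G (Ici midpointI) ≤ 2⁻¹ * eVariationOn g (Ici midpointI) := by
    refine eVariationOn_pieces_le (φ := lowerBranch) (χ := upperBranch) (t := Icc midpointI r)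
      (u := Ici r) ?_ ?_ ?_ ?_ (fun x hx y hy => le_trans hx.2 hy) ?_ fun x => rfl
    · intro x hx y hy h
      rw [mem_Ici, ← Subtype.coe_le_coe, coe_midpointI] at hx hy
      rw [← Subtype.coe_le_coe] at h ⊢
      rw [coe_lowerBranch, coe_lowerBranch, if_neg hx.not_gt, if_neg hy.not_gt]
      linarith
    · intro x hx y hy h
      rw [mem_Ici, ← Subtype.coe_le_coe, coe_midpointI] at hx hy
      rw [← Subtype.coe_le_coe] at h ⊢
      rw [coe_upperBranch, coe_upperBranch, if_neg hx.not_gt, if_neg hy.not_gt]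
      linarith
    · intro x hx
      rw [mem_Ici, ← Subtype.coe_le_coe, coe_midpointI] at hx
      rw [mem_Icc, ← Subtype.coe_le_coe, ← Subtype.coe_le_coe, coe_lowerBranch, if_neg hx.not_gt,
        hr, coe_midpointI]
      exact ⟨by linarith, by linarith [x.2.2]⟩
    · intro x hx
      rw [mem_Ici, ← Subtype.coe_le_coe, coe_midpointI] at hx
      rw [mem_Ici, ← Subtype.coe_le_coe, coe_upperBranch, if_neg hx.not_gt, hr]
      linarith
    · refine union_subset (fun x hx => hx.1) (Ici_subset_Ici.2 ?_)
      rw [← Subtype.coe_le_coe, hr, coe_midpointI]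
      norm_num
  have hjump : edist (G midpointI) (G₀ midpointI) ≤ 2⁻¹ * eVariationOn g univ := by
    have e1 : lowerBranch midpointI = midpointI := by
      ext; rw [coe_lowerBranch, coe_midpointI]; norm_num
    have e2 : upperBranch midpointI = r := by
      ext; rw [coe_upperBranch, coe_midpointI, hr]; norm_num
    have e3 : leftBranch midpointI = q := by
      ext; rw [coe_leftBranch, coe_midpointI, hq]; norm_num
    have e4 : χ midpointI = midpointI := by
      ext; rw [hχ, coe_midpointI]; norm_num
    simp only [hG, hG₀, e1, e2, e3, e4]
    rw [add_comm (g q)]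
    refine (edist_average_le _ _ _ _).trans ?_
    rw [edist_self, zero_add]
    gcongr
    exact eVariationOn.edist_le g (mem_univ _) (mem_univ _)
  have hEq : eVariationOn G (Iic midpointI) ≤
      eVariationOn G₀ (Iic midpointI) + edist (G midpointI) (G₀ midpointI) := by
    refine eVariationOn_le_add_edist isGreatest_Iic fun x hx hne => ?_
    have hlt : (x : ℝ) < 1 / 2 := lt_of_le_of_ne hx fun h => hne (Subtype.ext h)
    have e1 : lowerBranch x = leftBranch x := by
      ext; rw [coe_lowerBranch, if_pos hlt, coe_leftBranch, add_zero]
    have e2 : upperBranch x = χ x := by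
      ext; rw [coe_upperBranch, if_pos hlt, hχ]
    simp only [hG, hG₀, e1, e2]
  calc eVariationOn G univ
      = eVariationOn G (Iic midpointI) + eVariationOn G (Ici midpointI) := by
        rw [← Iic_union_Ici (a := midpointI)]
        exact eVariationOn.union G isGreatest_Iic isLeast_Ici
    _ ≤ (2⁻¹ * eVariationOn g (Iic midpointI) + 2⁻¹ * eVariationOn g univ) +
          2⁻¹ * eVariationOn g (Ici midpointI) :=
        add_le_add (hEq.trans (add_le_add hleft hjump)) hright
    _ = 2⁻¹ * (eVariationOn g (Iic midpointI) + eVariationOn g (Ici midpointI)) +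
          2⁻¹ * eVariationOn g univ := by ring
    _ = 2⁻¹ * eVariationOn g univ + 2⁻¹ * eVariationOn g univ := by
        rw [← eVariationOn.union g isGreatest_Iic isLeast_Ici, Iic_union_Ici]
    _ = eVariationOn g univ := by
        rw [← add_mul, ENNReal.inv_two_add_inv_two, one_mul]

theorem essVar_le_eVariationOn {f g : unitInterval → ℝ} (h : g =ᵐ[volume] f) :
    essVar f ≤ eVariationOn g univ := iInf₂_le g h

theorem IsTwoBranch.essVar_transfer_le {T a b : unitInterval → unitInterval}
    (hT : IsTwoBranch T a b) {c : ℝ≥0∞} (hc0 : c ≠ 0) (hc : c ≠ ⊤)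
    (h : ∀ g : unitInterval → ℝ,
      eVariationOn (fun x => (g (a x) + g (b x)) / 2) univ ≤ c * eVariationOn g univ) (φ : L1I) :
    essVar (hT.transfer φ) ≤ c * essVar φ := by
  conv_rhs => rw [essVar, ENNReal.mul_iInf_of_ne hc0 hc]
  refine le_iInf fun g => ?_
  rw [ENNReal.mul_iInf_of_ne hc0 hc]
  refine le_iInf fun hg => ?_
  exact (essVar_le_eVariationOn (hT.transfer_ae_of_ae_eq hg).symm).trans (h g)

theorem essVar_transfer_doubling_le (φ : L1I) :
    essVar (isTwoBranch_doubling.transfer φ) ≤ 2⁻¹ * essVar φ :=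
  isTwoBranch_doubling.essVar_transfer_le (by simp) (by simp) eVariationOn_doubling_le φ

theorem essVar_transfer_halfDoubling_le (φ : L1I) :
    essVar (isTwoBranch_halfDoubling.transfer φ) ≤ essVar φ := by
  simpa using isTwoBranch_halfDoubling.essVar_transfer_le one_ne_zero ENNReal.one_ne_top
    (fun g => by simpa using eVariationOn_halfDoubling_le g) φ

/-- A function of small variation is uniformly close to its mean. -/
theorem abs_sub_integral_le_of_essVar_lt {f : unitInterval → ℝ} (hf : Integrable f) {d : ℝ}
    (h : essVar f < ENNReal.ofReal d) : ∀ᵐ x, |f x - ∫ y, f y| ≤ d := by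
  obtain ⟨g, hg, hgd⟩ : ∃ g : unitInterval → ℝ, g =ᵐ[volume] f ∧
      eVariationOn g univ < ENNReal.ofReal d := by
    simpa only [essVar, iInf_lt_iff, exists_prop] using h
  have hd : 0 < d := ENNReal.ofReal_pos.1 (zero_le.trans_lt hgd)
  have hgi : Integrable g := hf.congr hg.symm
  have hdist : ∀ x y, |g x - g y| ≤ d := fun x y => by
    have h1 := (eVariationOn.edist_le g (mem_univ x) (mem_univ y)).trans hgd.le
    rwa [edist_dist, ENNReal.ofReal_le_ofReal_iff hd.le, Real.dist_eq] at h1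
  have hint : ∫ y, f y = ∫ y, g y := integral_congr_ae hg.symm
  filter_upwards [hg] with x hx
  rw [hint, ← hx]
  have h2 : g x - ∫ y, g y = ∫ y, (g x - g y) := by
    rw [integral_sub (integrable_const _) hgi]
    simp
  rw [h2]
  refine (abs_integral_le_integral_abs).trans ?_
  calc ∫ y, |g x - g y| ≤ ∫ _ : unitInterval, d :=
        integral_mono ((integrable_const _).sub hgi).abs (integrable_const _) (hdist x)
    _ = d := by simp

/-! ### The observable -/

/-- The observable as a function of the point of the interval only: `1` on `[0, 1/2]` and `-1` on
`(1/2, 1]`. -/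
noncomputable def halfSign (x : unitInterval) : ℝ := if (x : ℝ) ≤ 1 / 2 then 1 else -1

theorem obs_eq (p : Tower) : obs p = halfSign := by
  funext x
  unfold obs halfSign
  by_cases h : (x : ℝ) ≤ 1 / 2
  · rw [indicator_of_mem (by exact h), if_pos h]; norm_num
  · rw [indicator_of_notMem (by exact h), if_neg h]; norm_num

theorem halfSign_sq (x : unitInterval) : halfSign x ^ 2 = 1 := by
  unfold halfSign
  split_ifs <;> norm_num

theorem abs_halfSign (x : unitInterval) : |halfSign x| = 1 := by
  unfold halfSign
  split_ifs <;> norm_num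

theorem measurable_halfSign : Measurable halfSign :=
  Measurable.ite (measurableSet_coe_le _) measurable_const measurable_const

theorem memLp_halfSign (p : ℝ≥0∞) : MemLp halfSign p volume :=
  MemLp.of_bound measurable_halfSign.aestronglyMeasurable 1
    (ae_of_all _ fun x => by rw [Real.norm_eq_abs, abs_halfSign])

theorem integrable_halfSign : Integrable halfSign := memLp_one_iff_integrable.1 (memLp_halfSign 1)

theorem antitone_halfSign : Antitone halfSign := by
  intro x y h
  rw [← Subtype.coe_le_coe] at h
  unfold halfSign
  split_ifs <;> linarith

theorem essVar_halfSign_lt_top : essVar halfSign < ⊤ := by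
  refine (essVar_le_eVariationOn (ae_eq_refl halfSign)).trans_lt ?_
  have hm : Monotone (halfSign ∘ unitInterval.symm) :=
    antitone_halfSign.comp unitInterval.strictAnti_symm.antitone
  calc eVariationOn halfSign univ
      = eVariationOn ((halfSign ∘ unitInterval.symm) ∘ unitInterval.symm) univ := by
        congr 1
        funext x
        simp
    _ ≤ eVariationOn (halfSign ∘ unitInterval.symm) univ :=
        eVariationOn.comp_le_of_antitoneOn _ _ (unitInterval.strictAnti_symm.antitone.antitoneOn _)
          (mapsTo_univ _ _)
    _ = eVariationOn (halfSign ∘ unitInterval.symm) (univ ∩ Icc 0 1) := by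
        congr 1
        ext x
        simpa using unitInterval.le_one'
    _ < ⊤ := by
        rw [(hm.monotoneOn univ).eVariationOn_eq (mem_univ _) (mem_univ _)]
        exact ENNReal.ofReal_lt_top

theorem memBV_halfSign : MemBV halfSign := ⟨memLp_halfSign 1, essVar_halfSign_lt_top⟩

theorem halfSign_leftBranch (x : unitInterval) : halfSign (leftBranch x) = 1 :=
  if_pos (by rw [coe_leftBranch]; linarith [x.2.2])

theorem halfSign_rightBranch {x : unitInterval} (hx : (x : ℝ) ≠ 0) :
    halfSign (rightBranch x) = -1 :=
  if_neg (by
    have : 0 < (x : ℝ) := lt_of_le_of_ne x.2.1 (Ne.symm hx)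
    rw [coe_rightBranch]; linarith)

/-- The doubling map forgets the half in which a point lies. -/
theorem integral_halfSign_mul_comp_doubling {g : unitInterval → ℝ} (hg : MemLp g ∞ volume) :
    ∫ x, halfSign x * g (doubling x) = 0 := by
  rw [isTwoBranch_doubling.integral_mul_comp integrable_halfSign hg]
  refine integral_eq_zero_of_ae ?_
  filter_upwards [ae_coe_ne 0] with x hx
  rw [halfSign_leftBranch, halfSign_rightBranch hx]
  simp

theorem integral_halfSign : ∫ x, halfSign x = 0 := by
  simpa using integral_halfSign_mul_comp_doubling (g := fun _ => 1) (memLp_const 1)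

theorem average_halfSign_halfDoubling :
    (fun x => (halfSign (lowerBranch x) + halfSign (upperBranch x)) / 2) =ᵐ[volume] halfSign := by
  filter_upwards [ae_coe_ne (1 / 2)] with x hx
  have h0 := x.2.1
  have h1 := x.2.2
  unfold halfSign
  rw [coe_lowerBranch, coe_upperBranch]
  rcases lt_or_gt_of_ne hx with h | h
  · rw [if_pos h, if_pos h, if_pos (by linarith), if_pos (by linarith), if_pos h.le]
    norm_num
  · rw [if_neg h.le.not_gt, if_neg h.le.not_gt, if_neg (by linarith), if_neg (by linarith),
      if_neg h.not_ge]
    norm_num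

/-- Up to a null set, `halfDoubling` preserves each half of the interval; the exception `3/4`
is mapped to `1/2`, which belongs to the left half. -/
theorem halfSign_comp_halfDoubling : halfSign ∘ halfDoubling =ᵐ[volume] halfSign := by
  filter_upwards [ae_coe_ne (1 / 2), ae_coe_ne (3 / 4), ae_coe_ne 1] with x h2 h4 h1
  have h0 := x.2.1
  have h1 : (x : ℝ) < 1 := lt_of_le_of_ne x.2.2 h1
  simp only [Function.comp_apply]
  unfold halfSign
  rw [coe_halfDoubling]
  have hf0 := Int.fract_nonneg (4 * (x : ℝ))
  have hf1 := Int.fract_lt_one (4 * (x : ℝ))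
  rcases lt_or_gt_of_ne h2 with h | h
  · have e1 : ⌊2 * (x : ℝ)⌋ = 0 := Int.floor_eq_iff.2 ⟨by push_cast; linarith,
      by push_cast; linarith⟩
    rw [e1, if_pos h.le, if_pos (by push_cast; linarith)]
  · have e1 : ⌊2 * (x : ℝ)⌋ = 1 := Int.floor_eq_iff.2 ⟨by push_cast; linarith,
      by push_cast; linarith⟩
    have e2 : Int.fract (4 * (x : ℝ)) ≠ 0 := by
      intro h0
      have hfl := Int.floor_add_fract (4 * (x : ℝ))
      rw [h0, add_zero] at hfl
      have hl : (2 : ℝ) < ⌊4 * (x : ℝ)⌋ := by linarith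
      have hu : (⌊4 * (x : ℝ)⌋ : ℝ) < 4 := by linarith
      have h3 : ⌊4 * (x : ℝ)⌋ = 3 := by
        have hl' : 2 < ⌊4 * (x : ℝ)⌋ := by exact_mod_cast hl
        have hu' : ⌊4 * (x : ℝ)⌋ < 4 := by exact_mod_cast hu
        omega
      rw [h3] at hfl
      push_cast at hfl
      exact h4 (by linarith)
    have e3 : 0 < Int.fract (4 * (x : ℝ)) := lt_of_le_of_ne hf0 (Ne.symm e2)
    rw [e1, if_neg h.not_ge, if_neg (by push_cast; linarith)]

/-- The class of the observable in `L¹`. -/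
noncomputable def halfSignL1 : L1I := (memLp_halfSign 1).toLp halfSign

theorem coeFn_halfSignL1 : halfSignL1 =ᵐ[volume] halfSign := MemLp.coeFn_toLp _

theorem transfer_halfDoubling_halfSignL1 :
    isTwoBranch_halfDoubling.transfer halfSignL1 = halfSignL1 :=
  Lp.ext ((isTwoBranch_halfDoubling.transfer_ae_of_ae_eq coeFn_halfSignL1.symm).trans
    (average_halfSign_halfDoubling.trans coeFn_halfSignL1.symm))

theorem essVar_congr {f g : unitInterval → ℝ} (h : f =ᵐ[volume] g) : essVar f = essVar g := by
  unfold essVar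
  refine iInf_congr fun k => iInf_congr_Prop ⟨fun hk => hk.trans h, fun hk => hk.trans h.symm⟩
    fun _ => rfl

theorem bvNorm_congr {f g : unitInterval → ℝ} (h : f =ᵐ[volume] g) : bvNorm f = bvNorm g := by
  rw [bvNorm, bvNorm, essVar_congr h, eLpNorm_congr_ae h]

theorem MemBV.congr {f g : unitInterval → ℝ} (hf : MemBV f) (h : f =ᵐ[volume] g) : MemBV g :=
  ⟨hf.1.ae_eq h, essVar_congr h ▸ hf.2⟩

theorem MemBV.bvNorm_lt_top {f : unitInterval → ℝ} (hf : MemBV f) : bvNorm f < ⊤ :=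
  ENNReal.add_lt_top.2 ⟨hf.1.eLpNorm_lt_top, hf.2⟩

theorem one_le_bvNorm_halfSign : 1 ≤ bvNorm halfSign := by
  refine le_trans (le_of_eq ?_) le_self_add
  have h : eLpNorm halfSign 1 volume = eLpNorm (fun _ : unitInterval => (1 : ℝ)) 1 volume :=
    eLpNorm_congr_norm_ae (ae_of_all _ fun x => by simp [abs_halfSign])
  rw [h]
  simp [eLpNorm_one_eq_lintegral_enorm]

/-! ### The Bernoulli shift -/

/-- The left shift on two-sided sequences. -/
def leftShift (ω : SymbolSeq) : SymbolSeq := fun n => ω (n + 1)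

theorem leftShift_apply (ω : SymbolSeq) (n : ℤ) : leftShift ω n = ω (n + 1) := rfl

theorem iterate_leftShift_apply (k : ℕ) (ω : SymbolSeq) (n : ℤ) :
    leftShift^[k] ω n = ω (n + k) := by
  induction k generalizing ω with
  | zero => simp
  | succ k ih =>
    rw [Function.iterate_succ_apply, ih, leftShift_apply]
    congr 1
    push_cast
    ring

theorem measurable_leftShift : Measurable leftShift :=
  measurable_pi_lambda _ fun n => measurable_pi_apply (n + 1)

section Shift

variable (δ : ℝ) (hδ : 0 < δ)

instance : IsProbabilityMeasure (shiftMeasure δ hδ) := by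
  unfold shiftMeasure
  infer_instance

theorem measurePreserving_leftShift :
    MeasurePreserving leftShift (shiftMeasure δ hδ) (shiftMeasure δ hδ) :=
  ⟨measurable_leftShift, Measure.map_infinitePi_infinitePi_of_inj
    (P := fun _ : ℤ => (symbolLaw δ hδ).toMeasure) (f := fun n : ℤ => n + 1) (add_left_injective 1)⟩

/-- Cylinders over disjoint sets of coordinates are independent. -/
theorem shiftMeasure_inter_cylinder {s : Finset ℤ} {A : Set (∀ _ : s, ℕ+)} (hA : MeasurableSet A)
    {k : ℕ} (hk : ∀ i ∈ s, ∀ j ∈ s, i ≠ j + k) :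
    shiftMeasure δ hδ (cylinder s A ∩ leftShift^[k] ⁻¹' cylinder s A) =
      shiftMeasure δ hδ (cylinder s A) * shiftMeasure δ hδ (cylinder s A) := by
  have hind : ProbabilityTheory.iIndepFun (fun (i : ℤ) (ω : SymbolSeq) => ω i)
      (shiftMeasure δ hδ) :=
    ProbabilityTheory.iIndepFun_infinitePi (X := fun _ x => x) (fun _ => measurable_id)
  have hdisj : Disjoint s (s.image (fun j => j + (k : ℤ))) := by
    rw [Finset.disjoint_left]
    intro i hi hj
    obtain ⟨j, hj', h⟩ := Finset.mem_image.1 hj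
    exact hk i hi j hj' h.symm
  have h2 := hind.indepFun_finset s (s.image (fun j => j + (k : ℤ))) hdisj
    (fun i => measurable_pi_apply i)
  -- read the shifted coordinates from the translated index set
  let e : (∀ _ : (s.image (fun j => j + (k : ℤ)) : Finset ℤ), ℕ+) → (∀ _ : s, ℕ+) :=
    fun x i => x ⟨i + k, Finset.mem_image_of_mem _ i.2⟩
  have he : Measurable e := measurable_pi_lambda _ fun i => measurable_pi_apply _
  have h3 := h2.measure_inter_preimage_eq_mul A (e ⁻¹' A) hA (he hA)
  have e1 : (fun (ω : SymbolSeq) (i : s) => ω i) ⁻¹' A = cylinder s A := rfl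
  have e2 : (fun (ω : SymbolSeq) (i : (s.image (fun j => j + (k : ℤ)) : Finset ℤ)) => ω i) ⁻¹'
      (e ⁻¹' A) = leftShift^[k] ⁻¹' cylinder s A := by
    ext ω
    simp only [mem_preimage, mem_cylinder]
    have : e (fun i : (s.image (fun j => j + (k : ℤ)) : Finset ℤ) => ω i) =
        s.restrict (leftShift^[k] ω) := by
      funext i
      simp only [e, Finset.restrict, iterate_leftShift_apply]
    rw [this]
  rw [e1, e2] at h3
  rw [h3, ((measurePreserving_leftShift δ hδ).iterate k).measure_preimage
    (MeasurableSet.cylinder s hA).nullMeasurableSet]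

theorem exists_cylinder_symmDiff_lt {B : Set SymbolSeq} (hB : MeasurableSet B) {ε : ℝ≥0∞}
    (hε : 0 < ε) : ∃ (s : Finset ℤ) (A : Set (∀ _ : s, ℕ+)), MeasurableSet A ∧
      shiftMeasure δ hδ (symmDiff (cylinder s A) B) < ε := by
  obtain ⟨t, ht, htB⟩ := exists_measure_symmDiff_lt_of_generateFrom_isSetRing
    (μ := shiftMeasure δ hδ) (C := measurableCylinders (fun _ : ℤ => ℕ+))
    isSetRing_measurableCylinders ⟨{univ}, countable_singleton _,
      singleton_subset_iff.2 (univ_mem_measurableCylinders _), by simp⟩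
    generateFrom_measurableCylinders.symm hB hε
  obtain ⟨s, A, hA, rfl⟩ := (mem_measurableCylinders _).1 ht
  exact ⟨s, A, hA, htB⟩

/-- An invariant set `B` is approximated by a cylinder `A`, and `A` is independent of its translates
by large times; hence `B` is independent of itself. -/
theorem ergodic_leftShift : Ergodic leftShift (shiftMeasure δ hδ) := by
  refine ⟨measurePreserving_leftShift δ hδ, ⟨fun B hB hinv => ?_⟩⟩
  set μ := shiftMeasure δ hδ with hμ
  have key : ∀ ε : ℝ, 0 < ε → |μ.real B - μ.real B * μ.real B| ≤ 4 * ε := by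
    intro ε hε
    obtain ⟨s, A, hA, hAB⟩ := exists_cylinder_symmDiff_lt δ hδ hB (ENNReal.ofReal_pos.2 hε)
    set C : Set SymbolSeq := cylinder (α := fun _ : ℤ => ℕ+) s A with hC
    have hCm : MeasurableSet C := MeasurableSet.cylinder s hA
    have hCB : μ.real (symmDiff C B) ≤ ε := ENNReal.toReal_le_of_le_ofReal hε.le hAB.le
    -- a translation that moves the coordinates of the cylinder off themselves
    obtain ⟨k, hk⟩ : ∃ k : ℕ, ∀ i ∈ s, ∀ j ∈ s, i ≠ j + k := by
      obtain ⟨M, hM⟩ := (s.image (fun i => |i|)).bddAbove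
      refine ⟨(2 * |M| + 1).toNat, fun i hi j hj h => ?_⟩
      have h1 := hM (Finset.mem_coe.2 (Finset.mem_image_of_mem (fun i => |i|) hi))
      have h2 := hM (Finset.mem_coe.2 (Finset.mem_image_of_mem (fun i => |i|) hj))
      have h3 := le_abs_self i
      have h4 := neg_abs_le j
      have h5 := le_abs_self M
      rw [Int.toNat_of_nonneg (by positivity)] at h
      omega
    have hmp := (measurePreserving_leftShift δ hδ).iterate k
    have hinvk : leftShift^[k] ⁻¹' B = B := by
      rw [Set.preimage_iterate_eq]
      exact Function.iterate_fixed hinv k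
    have hprod : μ.real (C ∩ leftShift^[k] ⁻¹' C) = μ.real C * μ.real C := by
      rw [measureReal_def, shiftMeasure_inter_cylinder δ hδ hA hk, ENNReal.toReal_mul]
      rfl
    have hshift : μ.real (symmDiff (leftShift^[k] ⁻¹' C) B) ≤ ε := by
      have : symmDiff (leftShift^[k] ⁻¹' C) B = leftShift^[k] ⁻¹' symmDiff C B := by
        conv_lhs => rw [← hinvk]
        rfl
      rw [this, measureReal_def, hmp.measure_preimage (hCm.symmDiff hB).nullMeasurableSet]
      exact hCB
    have h1 : |μ.real C - μ.real B| ≤ ε :=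
      (abs_measureReal_sub_le_measureReal_symmDiff hCm.nullMeasurableSet hB.nullMeasurableSet).trans
        hCB
    have h2 : |μ.real (C ∩ leftShift^[k] ⁻¹' C) - μ.real B| ≤ 2 * ε := by
      refine (abs_measureReal_sub_le_measureReal_symmDiff
        (hCm.inter (hmp.measurable hCm)).nullMeasurableSet hB.nullMeasurableSet).trans ?_
      have hsub : symmDiff (C ∩ leftShift^[k] ⁻¹' C) B ⊆
          symmDiff C B ∪ symmDiff (leftShift^[k] ⁻¹' C) B := by
        intro x hx
        simp only [mem_symmDiff, mem_inter_iff, mem_union] at hx ⊢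
        tauto
      calc _ ≤ μ.real (symmDiff C B ∪ symmDiff (leftShift^[k] ⁻¹' C) B) := measureReal_mono hsub
        _ ≤ _ := measureReal_union_le _ _
        _ ≤ 2 * ε := by linarith
    have hC1 : μ.real C ≤ 1 := measureReal_le_one
    have hB1 : μ.real B ≤ 1 := measureReal_le_one
    have hC0 : 0 ≤ μ.real C := measureReal_nonneg
    have hB0 : 0 ≤ μ.real B := measureReal_nonneg
    rw [hprod] at h2
    rw [abs_le] at h1 h2 ⊢
    constructor <;> nlinarith
  have h0 : μ.real B = μ.real B * μ.real B := by
    by_contra hne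
    have hpos : 0 < |μ.real B - μ.real B * μ.real B| := abs_pos.2 (sub_ne_zero.2 hne)
    have := key (|μ.real B - μ.real B * μ.real B| / 8) (by positivity)
    linarith
  rw [eventuallyConst_set]
  have h01 : μ.real B = 0 ∨ μ.real B = 1 := by
    have : μ.real B * (μ.real B - 1) = 0 := by linarith
    rcases mul_eq_zero.1 this with h | h
    · exact Or.inl h
    · exact Or.inr (by linarith)
  rcases h01 with h | h
  · right
    rw [measureReal_eq_zero_iff] at h
    exact measure_eq_zero_iff_ae_notMem.1 h
  · left
    have hB' : μ B = 1 := by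
      rw [← ENNReal.ofReal_one, ← h, measureReal_def, ENNReal.ofReal_toReal (measure_ne_top _ _)]
    exact (prob_compl_eq_zero_iff hB).2 hB'

end Shift

/-! ### The tower measure -/

/-- Extension of a function on the tower by zero to `SymbolSeq × ℕ`. -/
noncomputable def towerExtend (F : Tower → ℝ≥0∞) : SymbolSeq × ℕ → ℝ≥0∞ :=
  Function.extend Subtype.val F 0

theorem towerExtend_of_lt (F : Tower → ℝ≥0∞) {ω : SymbolSeq} {i : ℕ} (h : i < (ω 0 : ℕ)) :
    towerExtend F (ω, i) = F ⟨(ω, i), h⟩ :=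
  Subtype.val_injective.extend_apply F 0 (⟨(ω, i), h⟩ : Tower)

theorem towerExtend_of_not_lt (F : Tower → ℝ≥0∞) {ω : SymbolSeq} {i : ℕ} (h : ¬ i < (ω 0 : ℕ)) :
    towerExtend F (ω, i) = 0 :=
  Function.extend_apply' _ _ _ fun ⟨p, hp⟩ => h (by have := p.2; rw [hp] at this; exact this)

theorem measurable_roof : Measurable (fun ω : SymbolSeq => (ω 0 : ℕ)) :=
  (measurable_of_countable (fun n : ℕ+ => (n : ℕ))).comp (measurable_pi_apply 0)

theorem measurableSet_tower : MeasurableSet {q : SymbolSeq × ℕ | q.2 < (q.1 0 : ℕ)} :=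
  measurableSet_lt measurable_snd (measurable_roof.comp measurable_fst)

theorem measurableEmbedding_tower : MeasurableEmbedding (Subtype.val : Tower → SymbolSeq × ℕ) :=
  MeasurableEmbedding.subtype_coe measurableSet_tower

theorem measurable_towerExtend {F : Tower → ℝ≥0∞} (hF : Measurable F) :
    Measurable (towerExtend F) :=
  measurableEmbedding_tower.measurable_extend hF measurable_zero

section Tower

variable (δ : ℝ) (hδ : 0 < δ)

/-- The mean `∫ h dℚ` of the roof function. -/
noncomputable def meanRoof : ℝ≥0∞ := ∫⁻ ω, ((ω 0 : ℕ) : ℝ≥0∞) ∂(shiftMeasure δ hδ)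

/-- Integration over the tower is integration over the base of the sums over the columns. -/
theorem lintegral_towerMeasure {F : Tower → ℝ≥0∞} (hF : Measurable F) :
    ∫⁻ p, F p ∂(towerMeasure δ hδ) =
      (meanRoof δ hδ)⁻¹ * ∫⁻ ω, ∑' i, towerExtend F (ω, i) ∂(shiftMeasure δ hδ) := by
  unfold towerMeasure
  rw [lintegral_smul_measure, smul_eq_mul]
  congr 1
  have hE := measurable_towerExtend hF
  have h1 : ∀ p : Tower, F p = towerExtend F p.1 := fun p =>
    (Subtype.val_injective.extend_apply F 0 p).symm
  have hr : range (Subtype.val : Tower → SymbolSeq × ℕ) = {q | q.2 < (q.1 0 : ℕ)} :=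
    Subtype.range_val
  have h2 : {q : SymbolSeq × ℕ | q.2 < (q.1 0 : ℕ)}.indicator (towerExtend F) = towerExtend F := by
    rw [indicator_eq_self]
    intro q hq
    by_contra hn
    exact hq (towerExtend_of_not_lt F hn)
  simp_rw [h1]
  rw [← lintegral_map hE measurable_subtype_coe, measurableEmbedding_tower.map_comap, hr,
    ← lintegral_indicator measurableSet_tower, h2, lintegral_prod _ hE.aemeasurable]
  simp only [lintegral_count]

/-- The coordinates of the Bernoulli shift have the law `symbolLaw`. -/
theorem lintegral_roof_comp (f : ℕ+ → ℝ≥0∞) (n : ℤ) :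
    ∫⁻ ω, f (ω n) ∂(shiftMeasure δ hδ) =
      (∑' k, symbolWeight δ k * f k) * (∑' k, symbolWeight δ k)⁻¹ := by
  have h : ∫⁻ ω, f (ω n) ∂(shiftMeasure δ hδ) = ∫⁻ k, f k ∂(symbolLaw δ hδ).toMeasure := by
    rw [← Measure.infinitePi_map_eval (fun _ : ℤ => (symbolLaw δ hδ).toMeasure) n,
      lintegral_map (measurable_of_countable f) (measurable_pi_apply n)]
    rfl
  rw [h, lintegral_countable', ← ENNReal.tsum_mul_right]
  refine tsum_congr fun k => ?_
  rw [PMF.toMeasure_apply_singleton _ _ (measurableSet_singleton k), symbolLaw,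
    PMF.normalize_apply]
  ring

theorem symbolWeight_mul_pow (k : ℕ+) (j : ℕ) :
    symbolWeight δ k * ((k : ℕ) : ℝ≥0∞) ^ j =
      ENNReal.ofReal (1 / ((k : ℕ) : ℝ) ^ (2 + δ - j)) := by
  have hk : (0 : ℝ) < (k : ℕ) := by exact_mod_cast k.pos
  rw [symbolWeight, ← ENNReal.ofReal_natCast, ← ENNReal.ofReal_pow hk.le,
    ← ENNReal.ofReal_mul (by positivity), Real.rpow_sub hk, Real.rpow_natCast]
  congr 1
  have : (0 : ℝ) < ((k : ℕ) : ℝ) ^ (2 + δ) := Real.rpow_pos_of_pos hk _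
  field_simp

theorem meanRoof_ne_top : meanRoof δ hδ ≠ ⊤ := by
  rw [meanRoof, lintegral_roof_comp δ hδ (fun k => ((k : ℕ) : ℝ≥0∞)) 0]
  refine ENNReal.mul_ne_top ?_ (ENNReal.inv_ne_top.2 (tsum_symbolWeight_ne_zero δ))
  have h : Summable (fun n : ℕ => 1 / (n : ℝ) ^ (2 + δ - (1 : ℕ))) :=
    Real.summable_one_div_nat_rpow.2 (by push_cast; linarith)
  have h' : Summable (fun n : ℕ+ => 1 / ((n : ℕ) : ℝ) ^ (2 + δ - (1 : ℕ))) :=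
    h.comp_injective PNat.coe_injective
  have e : ∀ k : ℕ+, symbolWeight δ k * ((k : ℕ) : ℝ≥0∞) =
      ENNReal.ofReal (1 / ((k : ℕ) : ℝ) ^ (2 + δ - (1 : ℕ))) := fun k => by
    rw [← symbolWeight_mul_pow, pow_one]
  simp_rw [e]
  exact h'.tsum_ofReal_ne_top

theorem meanRoof_ne_zero : meanRoof δ hδ ≠ 0 := by
  have h : (1 : ℝ≥0∞) ≤ meanRoof δ hδ := by
    calc (1 : ℝ≥0∞) = ∫⁻ _, 1 ∂(shiftMeasure δ hδ) := by simp
      _ ≤ _ := lintegral_mono fun ω => by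
        change (1 : ℝ≥0∞) ≤ ((ω 0 : ℕ) : ℝ≥0∞)
        exact_mod_cast (ω 0).pos
  exact (zero_lt_one.trans_le h).ne'

/-- The roof function has infinite second moment. -/
theorem lintegral_roof_sq (hδ1 : δ ≤ 1) (n : ℤ) :
    ∫⁻ ω, ((ω n : ℕ) : ℝ≥0∞) ^ 2 ∂(shiftMeasure δ hδ) = ⊤ := by
  rw [lintegral_roof_comp δ hδ (fun k => ((k : ℕ) : ℝ≥0∞) ^ 2) n]
  have h : ∑' k, symbolWeight δ k * ((k : ℕ) : ℝ≥0∞) ^ 2 = ⊤ := by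
    simp_rw [symbolWeight_mul_pow]
    by_contra hne
    have h1 := ENNReal.summable_toReal hne
    have h2 : Summable (fun n : ℕ+ => 1 / ((n : ℕ) : ℝ) ^ δ) := by
      refine h1.congr fun k => ?_
      rw [ENNReal.toReal_ofReal (by positivity)]
      congr 2
      push_cast
      ring
    have h3 : Summable (fun n : ℕ => 1 / (n : ℝ) ^ δ) := by
      rw [← summable_pnat_iff_summable_nat (f := fun n : ℕ => 1 / (n : ℝ) ^ δ)]
      exact h2
    exact absurd (Real.summable_one_div_nat_rpow.1 h3) (not_lt.2 hδ1)
  rw [h, ENNReal.top_mul (ENNReal.inv_ne_zero.2 (tsum_symbolWeight_ne_top hδ))]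

theorem tsum_towerExtend_one (ω : SymbolSeq) :
    ∑' i, towerExtend (fun _ => 1) (ω, i) = ((ω 0 : ℕ) : ℝ≥0∞) := by
  rw [tsum_eq_sum (s := Finset.range (ω 0)) fun i hi =>
    towerExtend_of_not_lt _ (by simpa using hi)]
  rw [Finset.sum_congr rfl fun i hi => towerExtend_of_lt _ (Finset.mem_range.1 hi)]
  simp

instance : IsProbabilityMeasure (towerMeasure δ hδ) := by
  refine ⟨?_⟩
  rw [← lintegral_one, lintegral_towerMeasure δ hδ measurable_const]
  simp_rw [tsum_towerExtend_one]
  exact ENNReal.inv_mul_cancel (meanRoof_ne_zero δ hδ) (meanRoof_ne_top δ hδ)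

/-- A property that holds for `ℚ`-almost every base point holds on almost every column. -/
theorem quasiMeasurePreserving_tower_fst :
    Measure.QuasiMeasurePreserving (fun p : Tower => p.1.1) (towerMeasure δ hδ)
      (shiftMeasure δ hδ) := by
  have hm : Measurable (fun p : Tower => p.1.1) := measurable_fst.comp measurable_subtype_coe
  refine ⟨hm, Measure.AbsolutelyContinuous.mk fun s hs h0 => ?_⟩
  rw [Measure.map_apply hm hs, ← lintegral_indicator_one (hm hs),
    lintegral_towerMeasure δ hδ (measurable_one.indicator (hm hs))]
  refine mul_eq_zero_of_right _ ?_
  refine (lintegral_congr_ae ?_).trans lintegral_zero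
  filter_upwards [measure_eq_zero_iff_ae_notMem.1 h0] with ω hω
  simp only [ENNReal.tsum_eq_zero]
  intro i
  by_cases hi : i < (ω 0 : ℕ)
  · rw [towerExtend_of_lt _ hi]
    exact indicator_of_notMem (by exact hω) _
  · exact towerExtend_of_not_lt _ hi

/-- Every bottom piece `{h = m} × {0}` of the tower has positive measure. -/
theorem towerMeasure_bottom_pos (m : ℕ+) :
    0 < towerMeasure δ hδ {p : Tower | p.1.1 0 = m ∧ p.1.2 = 0} := by
  have hs : MeasurableSet {p : Tower | p.1.1 0 = m ∧ p.1.2 = 0} :=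
    (((measurable_pi_apply (X := fun _ : ℤ => ℕ+) 0).comp
      (measurable_fst.comp measurable_subtype_coe)) (measurableSet_singleton m)).inter
      ((measurable_snd.comp measurable_subtype_coe) (measurableSet_singleton 0))
  rw [← lintegral_indicator_one hs, lintegral_towerMeasure δ hδ (measurable_one.indicator hs)]
  refine ENNReal.mul_pos (ENNReal.inv_ne_zero.2 (meanRoof_ne_top δ hδ)) (ne_of_gt ?_)
  classical
  have hlaw : 0 < ∫⁻ ω : SymbolSeq, (if ω 0 = m then 1 else 0) ∂(shiftMeasure δ hδ) := by
    rw [lintegral_roof_comp δ hδ (fun k => if k = m then 1 else 0) 0]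
    refine ENNReal.mul_pos ?_ (ENNReal.inv_ne_zero.2 (tsum_symbolWeight_ne_top hδ))
    rw [ne_eq, ENNReal.tsum_eq_zero, not_forall]
    refine ⟨m, ?_⟩
    have hm : (0 : ℝ) < (m : ℕ) := by exact_mod_cast m.pos
    have : (0 : ℝ) < ((m : ℕ) : ℝ) ^ (2 + δ) := Real.rpow_pos_of_pos hm _
    rw [if_pos rfl, mul_one, symbolWeight, ENNReal.ofReal_eq_zero, not_le]
    positivity
  refine hlaw.trans_le (lintegral_mono fun ω => ?_)
  refine le_trans ?_ (ENNReal.le_tsum 0)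
  rw [towerExtend_of_lt _ (PNat.pos _)]
  split_ifs with h
  · rw [indicator_of_mem (by exact ⟨h, rfl⟩)]
    rfl
  · exact zero_le

/-! ### The tower map -/

theorem towerMap_of_lt {ω : SymbolSeq} {i : ℕ} (h : i + 1 < (ω 0 : ℕ)) (hi : i < (ω 0 : ℕ)) :
    towerMap ⟨(ω, i), hi⟩ = ⟨(ω, i + 1), h⟩ := dif_pos h

theorem towerMap_of_not_lt {ω : SymbolSeq} {i : ℕ} (h : ¬ i + 1 < (ω 0 : ℕ)) (hi : i < (ω 0 : ℕ)) :
    towerMap ⟨(ω, i), hi⟩ = ⟨(leftShift ω, 0), PNat.pos _⟩ := dif_neg h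

instance : BorelSpace ℕ+ := ⟨by
  rw [borel_eq_top_of_discrete]; rfl⟩

/-- Conditions on the height of the column and on the level define clopen sets, since both are
discrete. -/
theorem isClopen_roof {f : SymbolSeq × ℕ → Prop}
    (h : ∃ g : ℕ+ × ℕ → Prop, ∀ q, f q ↔ g (q.1 0, q.2)) : IsClopen {q | f q} := by
  obtain ⟨g, hg⟩ := h
  have hc : Continuous (fun q : SymbolSeq × ℕ => (q.1 0, q.2)) := by fun_prop
  have := (isClopen_discrete {x | g x}).preimage hc
  convert this using 1
  ext q
  exact hg q

theorem continuous_towerMap : Continuous towerMap := by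
  rw [continuous_induced_rng]
  have hcl : IsClopen {p : Tower | p.1.2 + 1 < (p.1.1 0 : ℕ)} :=
    (isClopen_roof ⟨fun x => x.2 + 1 < (x.1 : ℕ), fun q => Iff.rfl⟩).preimage
      continuous_subtype_val
  have e : Subtype.val ∘ towerMap = fun p : Tower =>
      if p.1.2 + 1 < (p.1.1 0 : ℕ) then (p.1.1, p.1.2 + 1) else (fun n => p.1.1 (n + 1), 0) := by
    funext p
    rcases p with ⟨⟨ω, i⟩, hi⟩
    simp only [Function.comp_apply]
    split_ifs with h
    · rw [towerMap_of_lt h]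
    · rw [towerMap_of_not_lt h]; rfl
  rw [e]
  refine Continuous.if (fun p hp => ?_) (by fun_prop) (by fun_prop)
  rw [hcl.frontier_eq] at hp
  exact hp.elim

theorem continuous_towerMap_symm : Continuous towerMap.symm := by
  rw [continuous_induced_rng]
  have hcl : IsClopen {p : Tower | p.1.2 = 0} :=
    (isClopen_roof ⟨fun x => x.2 = 0, fun q => Iff.rfl⟩).preimage continuous_subtype_val
  have e : Subtype.val ∘ towerMap.symm = fun p : Tower =>
      if p.1.2 = 0 then (fun n => p.1.1 (n - 1), (p.1.1 (0 - 1) : ℕ) - 1)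
      else (p.1.1, p.1.2 - 1) := by
    funext p
    change (towerMap.invFun p).1 = _
    simp only [towerMap]
    split_ifs <;> rfl
  rw [e]
  refine Continuous.if (fun p hp => ?_) ?_ (by fun_prop)
  · rw [hcl.frontier_eq] at hp
    exact hp.elim
  · refine Continuous.prodMk (by fun_prop) ?_
    exact (continuous_of_discreteTopology (f := fun n : ℕ+ => (n : ℕ) - 1)).comp (by fun_prop)

theorem isHomeomorph_towerMap : IsHomeomorph towerMap :=
  (Homeomorph.mk towerMap continuous_towerMap continuous_towerMap_symm).isHomeomorph

theorem measurable_towerMap : Measurable towerMap := continuous_towerMap.measurable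

theorem measurable_towerMap_symm : Measurable towerMap.symm := continuous_towerMap_symm.measurable

/-- Along a column the tower map shifts the levels by one, and the top level is sent to the bottom
of the next column. -/
theorem towerExtend_comp_towerMap (F : Tower → ℝ≥0∞) (ω : SymbolSeq) (i : ℕ) :
    towerExtend (F ∘ towerMap) (ω, i) = towerExtend F (ω, i + 1) +
      if i + 1 = (ω 0 : ℕ) then towerExtend F (leftShift ω, 0) else 0 := by
  rcases lt_trichotomy (i + 1) (ω 0 : ℕ) with h | h | h
  · rw [towerExtend_of_lt _ (by omega : i < (ω 0 : ℕ)), if_neg h.ne, add_zero,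
      towerExtend_of_lt _ h, Function.comp_apply, towerMap_of_lt h]
  · rw [towerExtend_of_lt _ (by omega : i < (ω 0 : ℕ)), if_pos h,
      towerExtend_of_not_lt _ h.not_lt, zero_add, towerExtend_of_lt _ (PNat.pos _),
      Function.comp_apply, towerMap_of_not_lt h.not_lt]
  · rw [towerExtend_of_not_lt _ (by omega), towerExtend_of_not_lt _ (by omega), if_neg h.ne',
      add_zero]

theorem measurePreserving_towerMap :
    MeasurePreserving towerMap (towerMeasure δ hδ) (towerMeasure δ hδ) := by
  refine ⟨measurable_towerMap, Measure.ext_of_lintegral _ fun F hF => ?_⟩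
  rw [lintegral_map hF measurable_towerMap, lintegral_towerMeasure δ hδ hF]
  have h := lintegral_towerMeasure δ hδ (hF.comp measurable_towerMap)
  simp only [Function.comp_apply] at h
  rw [h]
  congr 1
  have hE := measurable_towerExtend hF
  have hE' : ∀ i, Measurable fun ω : SymbolSeq => towerExtend F (ω, i) := fun i =>
    hE.comp (measurable_id.prodMk measurable_const)
  have hsum : ∀ ω : SymbolSeq, ∑' i, towerExtend (F ∘ towerMap) (ω, i) =
      ∑' i, towerExtend F (ω, i + 1) + towerExtend F (leftShift ω, 0) := fun ω => by
    rw [tsum_congr (towerExtend_comp_towerMap F ω), ENNReal.tsum_add]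
    congr 1
    have h0 : (ω 0 : ℕ) - 1 + 1 = (ω 0 : ℕ) := Nat.sub_add_cancel (ω 0).pos
    rw [tsum_eq_single ((ω 0 : ℕ) - 1) fun i hi => if_neg (by omega), if_pos h0]
  simp_rw [hsum]
  have hL : Measurable fun ω : SymbolSeq => towerExtend F (leftShift ω, 0) :=
    (hE' 0).comp measurable_leftShift
  rw [lintegral_add_right _ hL,
    (measurePreserving_leftShift δ hδ).lintegral_comp (hE' 0),
    ← lintegral_add_right _ (hE' 0)]
  refine lintegral_congr fun ω => ?_
  rw [tsum_eq_zero_add' (f := fun i => towerExtend F (ω, i)) ENNReal.summable, add_comm]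

theorem iterate_towerMap {ω : SymbolSeq} {i k : ℕ} (hi : i < (ω 0 : ℕ)) (h : i + k < (ω 0 : ℕ)) :
    towerMap^[k] ⟨(ω, i), hi⟩ = ⟨(ω, i + k), h⟩ := by
  induction k with
  | zero => rfl
  | succ k ih =>
    rw [Function.iterate_succ_apply', ih (by omega), towerMap_of_lt (by omega)]
    rfl

/-- After `h(ω) - i` steps the orbit of `(ω, i)` is at the bottom of the next column. -/
theorem iterate_towerMap_return {ω : SymbolSeq} {i : ℕ} (hi : i < (ω 0 : ℕ)) :
    towerMap^[(ω 0 : ℕ) - i] ⟨(ω, i), hi⟩ = ⟨(leftShift ω, 0), PNat.pos _⟩ := by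
  obtain ⟨k, hk⟩ : ∃ k, (ω 0 : ℕ) - i = k + 1 := ⟨(ω 0 : ℕ) - i - 1, by omega⟩
  rw [hk, Function.iterate_succ_apply', iterate_towerMap hi (by omega),
    towerMap_of_not_lt (by omega)]

/-- A strictly invariant set is a union of whole columns over a shift-invariant base set. -/
theorem ergodic_towerMap : Ergodic towerMap (towerMeasure δ hδ) := by
  refine ⟨measurePreserving_towerMap δ hδ, ⟨fun s hs hinv => ?_⟩⟩
  have hbase : Measurable (fun ω : SymbolSeq => (⟨(ω, 0), PNat.pos _⟩ : Tower)) :=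
    (measurable_id.prodMk measurable_const).subtype_mk
  set B : Set SymbolSeq := {ω | (⟨(ω, 0), PNat.pos _⟩ : Tower) ∈ s} with hB
  have hmem : ∀ p, towerMap p ∈ s ↔ p ∈ s := fun p => by
    conv_rhs => rw [← hinv]
    rfl
  have hiter : ∀ (k : ℕ) (p : Tower), towerMap^[k] p ∈ s ↔ p ∈ s := fun k p => by
    induction k with
    | zero => rfl
    | succ k ih => rw [Function.iterate_succ_apply', hmem, ih]
  have hcol : ∀ p : Tower, p ∈ s ↔ p.1.1 ∈ B := by
    rintro ⟨⟨ω, i⟩, hi⟩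
    have h := hiter i ⟨(ω, 0), PNat.pos _⟩
    rw [iterate_towerMap (PNat.pos _) (by simpa using hi)] at h
    simp only [zero_add] at h
    exact h
  have hBinv : leftShift ⁻¹' B = B := by
    ext ω
    have h := hiter ((ω 0 : ℕ) - 0) ⟨(ω, 0), PNat.pos _⟩
    rw [iterate_towerMap_return] at h
    exact h
  have hconst := (ergodic_leftShift δ hδ).toPreErgodic.aeconst_set (hbase hs) hBinv
  rw [eventuallyConst_set] at hconst ⊢
  have hq := quasiMeasurePreserving_tower_fst δ hδ
  refine hconst.imp (fun h => ?_) (fun h => ?_)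
  · filter_upwards [hq.ae h] with p hp
    exact (hcol p).2 hp
  · filter_upwards [hq.ae h] with p hp
    exact fun hps => hp ((hcol p).1 hps)

end Tower

/-! ### The random maps and the covering time -/

theorem towerFamily_of_lt {p : Tower} (h : p.1.2 + 1 < (p.1.1 0 : ℕ)) :
    towerFamily p = halfDoubling := if_pos h

theorem towerFamily_of_not_lt {p : Tower} (h : ¬ p.1.2 + 1 < (p.1.1 0 : ℕ)) :
    towerFamily p = doubling := if_neg h

theorem measurableSet_notTop : MeasurableSet {p : Tower | p.1.2 + 1 < (p.1.1 0 : ℕ)} :=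
  measurableSet_lt ((measurable_snd.comp measurable_subtype_coe).add_const 1)
    (measurable_roof.comp (measurable_fst.comp measurable_subtype_coe))

theorem measurePreserving_towerFamily (p : Tower) :
    MeasurePreserving (towerFamily p) volume volume := by
  by_cases h : p.1.2 + 1 < (p.1.1 0 : ℕ)
  · rw [towerFamily_of_lt h]; exact isTwoBranch_halfDoubling.measurePreserving
  · rw [towerFamily_of_not_lt h]; exact isTwoBranch_doubling.measurePreserving

theorem isRandomSystem_tower (δ : ℝ) (hδ : 0 < δ) :
    IsRandomSystem (towerMeasure δ hδ) towerMap towerFamily where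
  prob := inferInstance
  measurable_symm := measurable_towerMap_symm
  ergodic := ergodic_towerMap δ hδ
  measurable_map := by
    have e : (fun q : Tower × unitInterval => towerFamily q.1 q.2) = fun q =>
        if q.1.1.2 + 1 < (q.1.1.1 0 : ℕ) then halfDoubling q.2 else doubling q.2 := by
      funext q
      unfold towerFamily
      split_ifs <;> rfl
    rw [e]
    exact Measurable.ite (measurable_fst measurableSet_notTop)
      (measurable_halfDoubling.comp measurable_snd) (measurable_doubling.comp measurable_snd)
  nonsingular p := (measurePreserving_towerFamily p).quasiMeasurePreserving

theorem mapCocycle_add {Ω : Type*} (σ : Equiv.Perm Ω) (T : Ω → unitInterval → unitInterval)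
    (m n : ℕ) (ω : Ω) :
    mapCocycle σ T (m + n) ω = mapCocycle σ T n (σ^[m] ω) ∘ mapCocycle σ T m ω := by
  induction n with
  | zero => rfl
  | succ n ih =>
    rw [← add_assoc, mapCocycle, ih, mapCocycle, ← Function.iterate_add_apply, add_comm n m]
    rfl

theorem measurePreserving_mapCocycle (n : ℕ) (p : Tower) :
    MeasurePreserving (mapCocycle towerMap towerFamily n p) volume volume := by
  induction n with
  | zero => exact MeasurePreserving.id _
  | succ n ih => exact (measurePreserving_towerFamily _).comp ih

/-- Within a column the cocycle consists of iterates of `halfDoubling`. -/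
theorem mapCocycle_of_lt {ω : SymbolSeq} {i k : ℕ} (hi : i < (ω 0 : ℕ)) (h : i + k < (ω 0 : ℕ)) :
    mapCocycle towerMap towerFamily k ⟨(ω, i), hi⟩ = halfDoubling^[k] := by
  induction k with
  | zero => rfl
  | succ k ih =>
    rw [mapCocycle, ih (by omega), iterate_towerMap hi (by omega),
      towerFamily_of_lt (by dsimp only; omega), Function.iterate_succ']

/-- When the orbit leaves a column the doubling map is applied once. -/
theorem mapCocycle_return {ω : SymbolSeq} {i k : ℕ} (hi : i < (ω 0 : ℕ))
    (h : i + k + 1 = (ω 0 : ℕ)) :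
    mapCocycle towerMap towerFamily (k + 1) ⟨(ω, i), hi⟩ = doubling ∘ halfDoubling^[k] := by
  rw [mapCocycle, mapCocycle_of_lt hi (by omega), iterate_towerMap hi (by omega),
    towerFamily_of_not_lt (by dsimp only; omega)]

/-- `halfDoubling` maps `[0, 1/2]` onto itself, including the endpoint `1/2`, which it fixes. -/
theorem halfDoubling_image_half :
    halfDoubling '' {x : unitInterval | (x : ℝ) ≤ 1 / 2} =
      {x : unitInterval | (x : ℝ) ≤ 1 / 2} := by
  ext y
  simp only [mem_image, mem_ofPred_eq]
  constructor
  · rintro ⟨x, hx, rfl⟩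
    rw [coe_halfDoubling]
    have h0 := x.2.1
    rcases eq_or_lt_of_le hx with h | h
    · have e1 : ⌊2 * (x : ℝ)⌋ = 1 := Int.floor_eq_iff.2 ⟨by push_cast; linarith,
        by push_cast; linarith⟩
      have e2 : Int.fract (4 * (x : ℝ)) = 0 :=
        Int.fract_eq_iff.2 ⟨by linarith, by linarith, 2, by push_cast; linarith⟩
      rw [e1, e2]
      norm_num
    · have e1 : ⌊2 * (x : ℝ)⌋ = 0 := Int.floor_eq_iff.2 ⟨by push_cast; linarith,
        by push_cast; linarith⟩
      rw [e1]
      have := Int.fract_lt_one (4 * (x : ℝ))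
      push_cast
      linarith
  · intro hy
    have h0 := y.2.1
    rcases eq_or_lt_of_le hy with h | h
    · refine ⟨y, hy, ?_⟩
      ext
      rw [coe_halfDoubling]
      have e1 : ⌊2 * (y : ℝ)⌋ = 1 := Int.floor_eq_iff.2 ⟨by push_cast; linarith,
        by push_cast; linarith⟩
      have e2 : Int.fract (4 * (y : ℝ)) = 0 :=
        Int.fract_eq_iff.2 ⟨by linarith, by linarith, 2, by push_cast; linarith⟩
      rw [e1, e2, h]
      norm_num
    · refine ⟨leftBranch y, by rw [coe_leftBranch]; linarith, ?_⟩
      ext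
      rw [coe_halfDoubling, coe_leftBranch]
      have e1 : ⌊2 * ((y : ℝ) / 2)⌋ = 0 := Int.floor_eq_iff.2 ⟨by push_cast; linarith,
        by push_cast; linarith⟩
      have e2 : Int.fract (4 * ((y : ℝ) / 2)) = 2 * y :=
        Int.fract_eq_iff.2 ⟨by linarith, by linarith, 0, by push_cast; ring⟩
      rw [e1, e2]
      push_cast
      ring

theorem iterate_halfDoubling_image_half (k : ℕ) :
    halfDoubling^[k] '' {x : unitInterval | (x : ℝ) ≤ 1 / 2} =
      {x : unitInterval | (x : ℝ) ≤ 1 / 2} := by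
  rw [Set.image_iterate_eq]
  exact Function.iterate_fixed halfDoubling_image_half k

theorem doubling_image_half : doubling '' {x : unitInterval | (x : ℝ) ≤ 1 / 2} = univ := by
  refine eq_univ_of_forall fun y => ⟨leftBranch y, ?_, ?_⟩
  · rw [mem_ofPred_eq, coe_leftBranch]
    linarith [y.2.2]
  · ext
    rw [coe_doubling, if_pos (by rw [coe_leftBranch]; linarith [y.2.2]), coe_leftBranch]
    ring

/-- The interval `[0, 1/2]` stays invariant until the orbit leaves the column, when the doubling map
spreads it over `[0, 1]`. -/
theorem isLeast_coveringTimes (p : Tower) :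
    IsLeast (coveringTimes p) ((p.1.1 0 : ℕ) - p.1.2) := by
  obtain ⟨⟨ω, i⟩, hi⟩ := p
  dsimp only at hi ⊢
  constructor
  · obtain ⟨k, hk⟩ : ∃ k, (ω 0 : ℕ) - i = k + 1 := ⟨(ω 0 : ℕ) - i - 1, by omega⟩
    rw [hk, coveringTimes, mem_ofPred_eq, mapCocycle_return hi (by omega), image_comp,
      iterate_halfDoubling_image_half, doubling_image_half]
  · intro k hk
    by_contra hlt
    rw [coveringTimes, mem_ofPred_eq, mapCocycle_of_lt hi (by omega),
      iterate_halfDoubling_image_half] at hk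
    have h1 : (1 : unitInterval) ∈ {x : unitInterval | (x : ℝ) ≤ 1 / 2} := hk ▸ mem_univ _
    have h2 : ((1 : unitInterval) : ℝ) ≤ 1 / 2 := h1
    norm_num at h2

theorem coveringTime_eq (p : Tower) : coveringTime p = (p.1.1 0 : ℕ) - p.1.2 :=
  (isLeast_coveringTimes p).csInf_eq

theorem measurable_coveringTime : Measurable coveringTime := by
  have e : coveringTime = fun p : Tower => (p.1.1 0 : ℕ) - p.1.2 := funext coveringTime_eq
  rw [e]
  exact (measurable_roof.comp (measurable_fst.comp measurable_subtype_coe)).sub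
    (measurable_snd.comp measurable_subtype_coe)

/-- Summing the covering time over a column of height `h` gives `h (h + 1) / 2`, and `h` has no
second moment. -/
theorem lintegral_coveringTime (δ : ℝ) (hδ : 0 < δ) (hδ1 : δ ≤ 1) :
    ∫⁻ p, (coveringTime p : ℝ≥0∞) ∂(towerMeasure δ hδ) = ⊤ := by
  have hm : Measurable fun p : Tower => (coveringTime p : ℝ≥0∞) :=
    (measurable_of_countable (fun n : ℕ => (n : ℝ≥0∞))).comp measurable_coveringTime
  rw [lintegral_towerMeasure δ hδ hm]
  refine ENNReal.mul_eq_top.2 (Or.inl ⟨ENNReal.inv_ne_zero.2 (meanRoof_ne_top δ hδ), ?_⟩)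
  have hcol : ∀ ω : SymbolSeq, 2⁻¹ * ((ω 0 : ℕ) : ℝ≥0∞) ^ 2 ≤
      ∑' i, towerExtend (fun p => (coveringTime p : ℝ≥0∞)) (ω, i) := by
    intro ω
    have h1 : ∑ i ∈ Finset.range (ω 0), towerExtend (fun p => (coveringTime p : ℝ≥0∞)) (ω, i) =
        ((∑ i ∈ Finset.range (ω 0), ((ω 0 : ℕ) - i) : ℕ) : ℝ≥0∞) := by
      rw [Nat.cast_sum]
      refine Finset.sum_congr rfl fun i hi => ?_
      rw [towerExtend_of_lt _ (Finset.mem_range.1 hi), coveringTime_eq]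
    refine le_trans ?_ (ENNReal.sum_le_tsum (Finset.range (ω 0)))
    rw [h1]
    have h2 : (ω 0 : ℕ) ^ 2 ≤ 2 * ∑ i ∈ Finset.range (ω 0), ((ω 0 : ℕ) - i) := by
      rw [← Finset.sum_range_reflect]
      have h3 : ∀ i ∈ Finset.range (ω 0), (ω 0 : ℕ) - ((ω 0 : ℕ) - 1 - i) = i + 1 := fun i hi => by
        have := Finset.mem_range.1 hi
        omega
      rw [Finset.sum_congr rfl h3, Finset.sum_add_distrib, mul_add, mul_comm 2 (∑ i ∈ _, i),
        Finset.sum_range_id_mul_two]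
      simp only [Finset.sum_const, Finset.card_range, smul_eq_mul, mul_one]
      obtain ⟨k, hk⟩ : ∃ k, (ω 0 : ℕ) = k + 1 := ⟨(ω 0 : ℕ) - 1, by have := (ω 0).pos; omega⟩
      rw [hk, Nat.add_sub_cancel]
      nlinarith
    calc 2⁻¹ * ((ω 0 : ℕ) : ℝ≥0∞) ^ 2
        ≤ 2⁻¹ * (2 * ((∑ i ∈ Finset.range (ω 0), ((ω 0 : ℕ) - i) : ℕ) : ℝ≥0∞)) := by
          gcongr
          exact_mod_cast h2
      _ = _ := by rw [← mul_assoc, ENNReal.inv_mul_cancel (by simp) (by simp), one_mul]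
  refine top_le_iff.1 (le_trans (le_of_eq ?_) (lintegral_mono hcol))
  rw [lintegral_const_mul' _ _ (by simp), lintegral_roof_sq δ hδ hδ1, ENNReal.mul_top (by simp)]

/-! ### The cocycle of transfer operators -/

/-- The transfer operators of the random maps. -/
noncomputable def towerTransfer (p : Tower) : L1I →L[ℝ] L1I :=
  if p.1.2 + 1 < (p.1.1 0 : ℕ) then isTwoBranch_halfDoubling.transfer
  else isTwoBranch_doubling.transfer

theorem towerTransfer_of_lt {p : Tower} (h : p.1.2 + 1 < (p.1.1 0 : ℕ)) :
    towerTransfer p = isTwoBranch_halfDoubling.transfer := if_pos h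

theorem towerTransfer_of_not_lt {p : Tower} (h : ¬ p.1.2 + 1 < (p.1.1 0 : ℕ)) :
    towerTransfer p = isTwoBranch_doubling.transfer := if_neg h

theorem isTransferOperator_tower (p : Tower) :
    IsTransferOperator (towerFamily p) (towerTransfer p) := by
  by_cases h : p.1.2 + 1 < (p.1.1 0 : ℕ)
  · rw [towerFamily_of_lt h, towerTransfer_of_lt h]
    exact isTwoBranch_halfDoubling.isTransferOperator
  · rw [towerFamily_of_not_lt h, towerTransfer_of_not_lt h]
    exact isTwoBranch_doubling.isTransferOperator

theorem towerTransfer_one (p : Tower) : towerTransfer p oneL1 = oneL1 := by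
  unfold towerTransfer
  split_ifs
  · exact isTwoBranch_halfDoubling.transfer_one
  · exact isTwoBranch_doubling.transfer_one

theorem norm_towerTransfer_le (p : Tower) (φ : L1I) : ‖towerTransfer p φ‖ ≤ ‖φ‖ := by
  unfold towerTransfer
  split_ifs
  · exact isTwoBranch_halfDoubling.norm_transfer_le φ
  · exact isTwoBranch_doubling.norm_transfer_le φ

theorem integral_towerTransfer (p : Tower) (φ : L1I) :
    ∫ x, towerTransfer p φ x = ∫ x, φ x := by
  unfold towerTransfer
  split_ifs
  · exact isTwoBranch_halfDoubling.integral_transfer φ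
  · exact isTwoBranch_doubling.integral_transfer φ

theorem towerTransfer_nonneg (p : Tower) {φ : L1I} (h : ∀ᵐ x, 0 ≤ φ x) :
    ∀ᵐ x, 0 ≤ towerTransfer p φ x := by
  unfold towerTransfer
  split_ifs
  · exact isTwoBranch_halfDoubling.transfer_nonneg h
  · exact isTwoBranch_doubling.transfer_nonneg h

/-- The factor by which the transfer operator contracts the variation: `1/2` at the top of a column
and `1` below it. -/
noncomputable def contraction (p : Tower) : ℝ :=
  if p.1.2 + 1 < (p.1.1 0 : ℕ) then 1 else 1 / 2

theorem contraction_pos (p : Tower) : 0 < contraction p := by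
  unfold contraction; split_ifs <;> norm_num

theorem contraction_le_one (p : Tower) : contraction p ≤ 1 := by
  unfold contraction; split_ifs <;> norm_num

theorem measurable_contraction : Measurable contraction :=
  Measurable.ite measurableSet_notTop measurable_const measurable_const

theorem essVar_towerTransfer_le (p : Tower) (φ : L1I) :
    essVar (towerTransfer p φ) ≤ ENNReal.ofReal (contraction p) * essVar φ := by
  unfold towerTransfer contraction
  split_ifs
  · rw [ENNReal.ofReal_one, one_mul]
    exact essVar_transfer_halfDoubling_le φ
  · rw [one_div, ENNReal.ofReal_inv_of_pos two_pos]
    simpa using essVar_transfer_doubling_le φ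

/-- The product of the contraction factors along the first `n` points of the orbit. -/
noncomputable def contractionProd (n : ℕ) (p : Tower) : ℝ :=
  ∏ j ∈ Finset.range n, contraction (towerMap^[j] p)

theorem contractionProd_pos (n : ℕ) (p : Tower) : 0 < contractionProd n p :=
  Finset.prod_pos fun _ _ => contraction_pos _

theorem antitone_contractionProd (p : Tower) : Antitone fun n => contractionProd n p :=
  antitone_nat_of_succ_le fun n => by
    rw [contractionProd, Finset.prod_range_succ]
    exact mul_le_of_le_one_right (contractionProd_pos n p).le (contraction_le_one _)

theorem measurable_contractionProd (n : ℕ) : Measurable (contractionProd n) :=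
  Finset.measurable_fun_prod _ fun j _ =>
    measurable_contraction.comp (measurable_towerMap.iterate j)

theorem contractionProd_add (m n : ℕ) (p : Tower) :
    contractionProd (m + n) p = contractionProd m p * contractionProd n (towerMap^[m] p) := by
  simp only [contractionProd, Finset.prod_range_add]
  congr 1
  refine Finset.prod_congr rfl fun j _ => ?_
  rw [← Function.iterate_add_apply, add_comm]

/-- Every orbit passes through the top of a column infinitely often. -/
theorem exists_contractionProd_le (J : ℕ) (p : Tower) :
    ∃ n, contractionProd n p ≤ (1 / 2) ^ J := by
  induction J generalizing p with
  | zero => exact ⟨0, by simp [contractionProd]⟩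
  | succ J ih =>
    obtain ⟨⟨ω, i⟩, hi⟩ := p
    dsimp only at hi
    obtain ⟨k, hk⟩ : ∃ k, i + k + 1 = (ω 0 : ℕ) := ⟨(ω 0 : ℕ) - i - 1, by omega⟩
    obtain ⟨n, hn⟩ := ih (towerMap^[k + 1] ⟨(ω, i), hi⟩)
    refine ⟨k + 1 + n, ?_⟩
    rw [contractionProd_add, pow_succ, mul_comm]
    refine mul_le_mul hn ?_ (contractionProd_pos _ _).le (by positivity)
    have htop : contraction (towerMap^[k] ⟨(ω, i), hi⟩) = 1 / 2 := by
      rw [iterate_towerMap hi (by omega)]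
      exact if_neg (by dsimp only; omega)
    rw [contractionProd, Finset.prod_range_succ, htop]
    exact mul_le_of_le_one_left (by norm_num)
      (Finset.prod_le_one (fun _ _ => (contraction_pos _).le) fun _ _ => contraction_le_one _)

theorem tendsto_contractionProd (p : Tower) :
    Tendsto (fun n => contractionProd n p) atTop (𝓝 0) := by
  rw [Metric.tendsto_atTop]
  intro ε hε
  obtain ⟨J, hJ⟩ := exists_pow_lt_of_lt_one hε (by norm_num : (1 / 2 : ℝ) < 1)
  obtain ⟨N, hN⟩ := exists_contractionProd_le J p
  refine ⟨N, fun n hn => ?_⟩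
  rw [Real.dist_0_eq_abs, abs_of_pos (contractionProd_pos n p)]
  exact ((antitone_contractionProd p hn).trans hN).trans_lt hJ

theorem essVar_opCocycle_le (n : ℕ) (p : Tower) (φ : L1I) :
    essVar (opCocycle towerMap towerTransfer n p φ) ≤
      ENNReal.ofReal (contractionProd n p) * essVar φ := by
  induction n with
  | zero => simp [contractionProd, opCocycle]
  | succ n ih =>
    rw [opCocycle, contractionProd, Finset.prod_range_succ,
      mul_comm (∏ j ∈ Finset.range n, contraction (towerMap^[j] p)),
      ENNReal.ofReal_mul (contraction_pos _).le, mul_assoc]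
    exact (essVar_towerTransfer_le _ _).trans (mul_le_mul_right ih _)

theorem integral_opCocycle (n : ℕ) (p : Tower) (φ : L1I) :
    ∫ x, opCocycle towerMap towerTransfer n p φ x = ∫ x, φ x := by
  induction n with
  | zero => rfl
  | succ n ih => rw [← ih]; exact integral_towerTransfer _ _

theorem opCocycle_nonneg (n : ℕ) (p : Tower) {φ : L1I} (h : ∀ᵐ x, 0 ≤ φ x) :
    ∀ᵐ x, 0 ≤ opCocycle towerMap towerTransfer n p φ x := by
  induction n with
  | zero => exact h
  | succ n ih => exact towerTransfer_nonneg _ ih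

/-! ### The cocycle is good -/

theorem essVar_const (c : ℝ) : essVar (fun _ => c) = 0 :=
  le_antisymm ((essVar_le_eVariationOn (ae_eq_refl _)).trans_eq
    (eVariationOn.constant_on (f := fun _ => c)
      (subsingleton_singleton.anti (image_subset_iff.2 fun _ _ => rfl)))) zero_le

theorem bvNorm_zero : bvNorm ((0 : L1I) : unitInterval → ℝ) = 0 := by
  have h : ((0 : L1I) : unitInterval → ℝ) =ᵐ[volume] fun _ => (0 : ℝ) := Lp.coeFn_zero _ _ _
  rw [bvNorm_congr h, bvNorm, essVar_const, add_zero]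
  exact eLpNorm_zero

theorem bvNorm_towerTransfer_le (p : Tower) (φ : L1I) : bvNorm (towerTransfer p φ) ≤ bvNorm φ := by
  refine add_le_add ?_ ((essVar_towerTransfer_le p φ).trans ?_)
  · have h := norm_towerTransfer_le p φ
    rwa [Lp.norm_def, Lp.norm_def,
      ENNReal.toReal_le_toReal (Lp.eLpNorm_ne_top _) (Lp.eLpNorm_ne_top _)] at h
  · refine mul_le_of_le_one_left zero_le ?_
    rw [ENNReal.ofReal_le_one]
    exact contraction_le_one p

theorem log_contraction : (fun p => Real.log (contraction p)) =
    {p : Tower | p.1.2 + 1 < (p.1.1 0 : ℕ)}ᶜ.indicator fun _ => Real.log (1 / 2) := by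
  funext p
  unfold contraction
  split_ifs with h
  · rw [indicator_of_notMem (notMem_compl_iff.2 (by exact h)), Real.log_one]
  · rw [indicator_of_mem (by exact h)]

theorem integrable_log_contraction (δ : ℝ) (hδ : 0 < δ) :
    Integrable (fun p => Real.log (contraction p)) (towerMeasure δ hδ) := by
  rw [log_contraction]
  exact (integrable_const _).indicator measurableSet_notTop.compl

theorem integral_log_contraction_neg (δ : ℝ) (hδ : 0 < δ) :
    ∫ p, Real.log (contraction p) ∂(towerMeasure δ hδ) < 0 := by
  rw [log_contraction, integral_indicator_const _ measurableSet_notTop.compl, smul_eq_mul]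
  refine mul_neg_of_pos_of_neg ?_ (Real.log_neg (by norm_num) (by norm_num))
  refine ENNReal.toReal_pos (ne_of_gt ?_) (measure_ne_top _ _)
  refine (towerMeasure_bottom_pos δ hδ 1).trans_le (measure_mono ?_)
  rintro p ⟨h1, h2⟩ h
  simp [h1, h2] at h

theorem norm_eq_integral_of_nonneg {h : L1I} (h0 : ∀ᵐ x, 0 ≤ h x) : ‖h‖ = ∫ x, h x := by
  rw [L1.norm_eq_integral_norm]
  refine integral_congr_ae ?_
  filter_upwards [h0] with x hx
  rw [Real.norm_eq_abs, abs_of_nonneg hx]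

/-- In the cone, `ℒⁿ h` has mean `‖h‖₁` and small variation once the contraction factors have
accumulated, so that it is bounded below by half of its mean. -/
theorem half_norm_le_opCocycle {a : ℝ} {h : L1I} (hh : h ∈ coneBV a) {n : ℕ}
    {p : Tower} (hn : a * contractionProd n p < 1 / 2) :
    ∀ᵐ x, 1 / 2 * ‖h‖ ≤ opCocycle towerMap towerTransfer n p h x := by
  obtain ⟨-, h0, hvar⟩ := hh
  rcases (norm_nonneg h).eq_or_lt with hz | hpos
  · rw [← hz, mul_zero]
    exact opCocycle_nonneg n p h0
  · have hlt : essVar (opCocycle towerMap towerTransfer n p h) < ENNReal.ofReal (1 / 2 * ‖h‖) := by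
      refine ((essVar_opCocycle_le n p h).trans (mul_le_mul_right hvar _)).trans_lt ?_
      rw [← ENNReal.ofReal_mul (contractionProd_pos n p).le,
        ENNReal.ofReal_lt_ofReal_iff (by positivity)]
      nlinarith
    filter_upwards [abs_sub_integral_le_of_essVar_lt (L1.integrable_coeFn _) hlt] with x hx
    rw [integral_opCocycle, ← norm_eq_integral_of_nonneg h0, abs_le] at hx
    linarith [hx.1]

theorem essInf_oneL1 : essInf (oneL1 : unitInterval → ℝ) volume = 1 := by
  rw [essInf_congr_ae coeFn_oneL1]
  exact essInf_const' _

theorem isGoodCocycle_tower (δ : ℝ) (hδ : 0 < δ) :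
    IsGoodCocycle (towerMeasure δ hδ) towerMap towerTransfer where
  borel := inferInstance
  borel_subset := by
    refine ⟨SymbolSeq × ℕ, inferInstance, inferInstance, inferInstance, inferInstance,
      Subtype.val, IsEmbedding.subtypeVal, ?_⟩
    exact measurableEmbedding_tower.measurableSet_range
  homeo := isHomeomorph_towerMap
  continuity := by
    refine ⟨fun k => if k = 0 then {p : Tower | p.1.2 + 1 < (p.1.1 0 : ℕ)}
      else {p : Tower | p.1.2 + 1 < (p.1.1 0 : ℕ)}ᶜ, fun k => ?_, ?_, ?_⟩
    · dsimp only
      split_ifs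
      · exact measurableSet_notTop
      · exact measurableSet_notTop.compl
    · refine eq_univ_of_forall fun p => mem_iUnion.2 ?_
      by_cases hp : p.1.2 + 1 < (p.1.1 0 : ℕ)
      · exact ⟨0, by rw [if_pos rfl]; exact hp⟩
      · exact ⟨1, by rw [if_neg one_ne_zero]; exact hp⟩
    · intro k p hp ε _
      filter_upwards [self_mem_nhdsWithin] with q hq φ _
      have hpq : towerTransfer q = towerTransfer p := by
        dsimp only at hp hq
        split_ifs at hp hq
        · rw [towerTransfer_of_lt hp, towerTransfer_of_lt hq]
        · rw [towerTransfer_of_not_lt hp, towerTransfer_of_not_lt hq]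
      rw [hpq, sub_self, bvNorm_zero]
      exact zero_le
  bounded := by
    refine ⟨fun _ => 1, measurable_const, fun _ => one_pos, by simp, ae_of_all _ fun p φ _ => ?_⟩
    rw [ENNReal.ofReal_one, one_mul]
    exact bvNorm_towerTransfer_le p φ
  lasotaYorke := by
    refine ⟨1, contraction, fun _ => 1, one_pos, measurable_contraction, measurable_const,
      contraction_pos, fun _ => one_pos, integrable_log_contraction δ hδ,
      integral_log_contraction_neg δ hδ, by simp, ae_of_all _ fun p φ _ => ?_⟩
    exact (essVar_towerTransfer_le p φ).trans le_self_add
  covering := by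
    intro a ha
    obtain ⟨J, hJ⟩ := exists_pow_lt_of_lt_one (show (0 : ℝ) < 1 / 2 / a by positivity)
      (by norm_num : (1 / 2 : ℝ) < 1)
    classical
    refine ⟨fun p => Nat.find (exists_contractionProd_le J p), fun _ _ => 1 / 2, ?_,
      fun _ => measurable_const, fun _ _ => by norm_num, ae_of_all _ fun p h hh n hn => ?_⟩
    · exact measurable_find _ fun n => measurableSet_le (measurable_contractionProd n)
        measurable_const
    · refine half_norm_le_opCocycle hh ?_
      have h1 := (antitone_contractionProd p hn).trans
        (Nat.find_spec (exists_contractionProd_le J p))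
      have h2 := (lt_div_iff₀ ha).1 (h1.trans_lt hJ)
      rwa [mul_comm] at h2
  essInf_pos := ae_of_all _ fun p => by rw [towerTransfer_one, essInf_oneL1]; exact one_pos
  essInf_log := by simp [towerTransfer_one, essInf_oneL1]

/-! ### Uniqueness of the equivariant density -/

theorem memBV_oneL1 : MemBV oneL1 := by
  refine ⟨Lp.memLp _, ?_⟩
  rw [essVar_congr coeFn_oneL1, essVar_const]
  exact ENNReal.zero_lt_top

theorem integral_oneL1 : ∫ x, oneL1 x = 1 := by
  rw [integral_congr_ae coeFn_oneL1]
  simp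

theorem isEquivariantDensity_one (δ : ℝ) (hδ : 0 < δ) :
    IsEquivariantDensity (towerMeasure δ hδ) towerMap towerTransfer (fun _ => oneL1) := by
  refine ⟨stronglyMeasurable_const, ae_of_all _ fun p => ⟨memBV_oneL1, ?_, integral_oneL1,
    towerTransfer_one p⟩⟩
  filter_upwards [coeFn_oneL1] with x hx
  rw [hx]
  exact zero_le_one

theorem norm_sub_oneL1_le {v : L1I} (hv : ∫ x, v x = 1) {d : ℝ}
    (h : essVar v < ENNReal.ofReal d) : ‖v - oneL1‖ ≤ d := by
  rw [L1.norm_eq_integral_norm]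
  calc ∫ x, ‖(v - oneL1 : L1I) x‖ ≤ ∫ _ : unitInterval, d := by
        refine integral_mono_ae (L1.integrable_coeFn _).norm (integrable_const _) ?_
        filter_upwards [Lp.coeFn_sub v oneL1, coeFn_oneL1,
          abs_sub_integral_le_of_essVar_lt (L1.integrable_coeFn v) h] with x h1 h2 h3
        rw [h1, Pi.sub_apply, h2, Real.norm_eq_abs]
        rwa [hv] at h3
    _ = d := by simp

/-- Along almost every orbit an equivariant density tends to `1`, because its variation is
contracted; by Poincaré recurrence it is `1`. -/
theorem equivariantDensity_eq_one (δ : ℝ) (hδ : 0 < δ) {v : Tower → L1I}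
    (hv : IsEquivariantDensity (towerMeasure δ hδ) towerMap towerTransfer v) :
    ∀ᵐ p ∂(towerMeasure δ hδ), v p = oneL1 := by
  obtain ⟨hmeas, hae⟩ := hv
  have hmp := measurePreserving_towerMap δ hδ
  have hall : ∀ᵐ p ∂(towerMeasure δ hδ), ∀ n : ℕ, MemBV (v (towerMap^[n] p)) ∧
      (∀ᵐ x, 0 ≤ v (towerMap^[n] p) x) ∧ ∫ x, v (towerMap^[n] p) x = 1 ∧
      towerTransfer (towerMap^[n] p) (v (towerMap^[n] p)) = v (towerMap (towerMap^[n] p)) :=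
    ae_all_iff.2 fun n => (hmp.iterate n).quasiMeasurePreserving.ae hae
  have hlim : ∀ᵐ p ∂(towerMeasure δ hδ),
      Tendsto (fun n => ‖v (towerMap^[n] p) - oneL1‖) atTop (𝓝 0) := by
    filter_upwards [hall] with p hp
    have hcoc : ∀ n, opCocycle towerMap towerTransfer n p (v p) = v (towerMap^[n] p) := fun n => by
      induction n with
      | zero => rfl
      | succ n ih =>
        rw [opCocycle, ContinuousLinearMap.comp_apply, ih, (hp n).2.2.2,
          Function.iterate_succ_apply']
    have hV : essVar (v p) ≠ ⊤ := (hp 0).1.2.ne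
    rw [Metric.tendsto_atTop]
    intro ε hε
    have hev : ∀ᶠ n in atTop, contractionProd n p * ((essVar (v p)).toReal) < ε / 2 := by
      have := (tendsto_contractionProd p).mul_const (essVar (v p)).toReal
      rw [zero_mul] at this
      exact this.eventually_lt_const (by positivity)
    obtain ⟨N, hN⟩ := eventually_atTop.1 hev
    refine ⟨N, fun n hn => ?_⟩
    rw [Real.dist_0_eq_abs, abs_norm]
    refine (norm_sub_oneL1_le (hp n).2.2.1 (d := ε / 2) ?_).trans_lt (by linarith)
    rw [← hcoc]
    refine (essVar_opCocycle_le n p (v p)).trans_lt ?_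
    rw [← ENNReal.ofReal_toReal hV, ← ENNReal.ofReal_mul (contractionProd_pos n p).le,
      ENNReal.ofReal_lt_ofReal_iff (by positivity)]
    exact hN n hn
  have hDm : Measurable fun p => ‖v p - oneL1‖ :=
    (hmeas.sub stronglyMeasurable_const).norm.measurable
  have hrec : ∀ᵐ p ∂(towerMeasure δ hδ), ∀ k : ℕ, ¬ (1 / ((k : ℝ) + 1) < ‖v p - oneL1‖) := by
    refine ae_all_iff.2 fun k => ?_
    have hs : MeasurableSet {p | 1 / ((k : ℝ) + 1) < ‖v p - oneL1‖} :=
      measurableSet_lt measurable_const hDm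
    filter_upwards [hlim, hmp.conservative.ae_mem_imp_frequently_image_mem hs.nullMeasurableSet]
      with p h1 h2 h3
    have h4 : ∀ᶠ n in atTop, ‖v (towerMap^[n] p) - oneL1‖ < 1 / ((k : ℝ) + 1) :=
      h1.eventually_lt_const (by positivity)
    obtain ⟨n, hn1, hn2⟩ := ((h2 h3).and_eventually h4).exists
    exact lt_asymm hn1 hn2
  filter_upwards [hrec] with p hp
  have h0 : ‖v p - oneL1‖ = 0 := by
    by_contra hne
    obtain ⟨k, hk⟩ := exists_nat_one_div_lt (lt_of_le_of_ne (norm_nonneg _) (Ne.symm hne))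
    exact hp k hk
  exact sub_eq_zero.1 (norm_eq_zero.1 h0)

/-! ### Failure of the scaling condition -/

theorem memBV_opCocycle (n : ℕ) (p : Tower) {φ : L1I} (hφ : MemBV φ) :
    MemBV (opCocycle towerMap towerTransfer n p φ) :=
  ⟨Lp.memLp _, (essVar_opCocycle_le n p φ).trans_lt (ENNReal.mul_lt_top ENNReal.ofReal_lt_top hφ.2)⟩

theorem opCocycle_halfSignL1 {ω : SymbolSeq} {n : ℕ} (h : n < (ω 0 : ℕ)) :
    opCocycle towerMap towerTransfer n ⟨(ω, 0), PNat.pos _⟩ halfSignL1 = halfSignL1 := by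
  induction n with
  | zero => rfl
  | succ n ih =>
    rw [opCocycle, ContinuousLinearMap.comp_apply, ih (by omega),
      iterate_towerMap (PNat.pos _) (by omega), towerTransfer_of_lt (by dsimp only; omega),
      transfer_halfDoubling_halfSignL1]

/-- The observable is fixed by the cocycle along a column. If the adapted constant were bounded,
its norm would decay at a uniform exponential rate, which is impossible along long columns. -/
theorem essSup_adaptedConstant (δ : ℝ) (hδ : 0 < δ) {K : Tower → ℝ}
    (hK : IsAdaptedConstant (towerMeasure δ hδ) towerMap towerTransfer K) :
    essSup (fun p => ENNReal.ofReal (K p) * bvNorm (obs p)) (towerMeasure δ hδ) = ⊤ := by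
  obtain ⟨-, hK1, lam, N, hlam, -, hN⟩ := hK
  by_contra hne
  simp_rw [obs_eq] at hne
  set M := essSup (fun p => ENNReal.ofReal (K p) * bvNorm halfSign) (towerMeasure δ hδ) with hM
  have hbd : ∀ᵐ p ∂(towerMeasure δ hδ), ENNReal.ofReal (K p) * bvNorm halfSign ≤ M :=
    ENNReal.ae_le_essSup _
  have hBV : MemBV halfSignL1 := memBV_halfSign.congr coeFn_halfSignL1.symm
  have hnorm : bvNorm halfSignL1 = bvNorm halfSign := bvNorm_congr coeFn_halfSignL1
  have hmean : ∫ x, halfSignL1 x = 0 := by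
    rw [integral_congr_ae coeFn_halfSignL1, integral_halfSign]
  have hone : 1 ≤ (bvNorm halfSign).toReal := by
    rw [← ENNReal.toReal_one]
    exact ENNReal.toReal_mono memBV_halfSign.bvNorm_lt_top.ne one_le_bvNorm_halfSign
  have hdecay : ∀ᵐ p ∂(towerMeasure δ hδ), ∀ n : ℕ,
      (bvNorm (opCocycle towerMap towerTransfer n p halfSignL1)).toReal ≤
        Real.exp (-lam * n) * M.toReal := by
    have hall : ∀ᵐ p ∂(towerMeasure δ hδ), ∀ n : ℕ, ∀ φ : L1I, MemBV φ →
        (bvNorm φ).toReal ≤ N (towerMap^[n] p) φ := ae_all_iff.2 fun n =>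
      ((measurePreserving_towerMap δ hδ).iterate n).quasiMeasurePreserving.ae
        (hN.mono fun p hp φ hφ => (hp.2 φ hφ).1)
    filter_upwards [hN, hbd, hall] with p h1 h2 h3 n
    obtain ⟨-, hup, hexp, -, -⟩ := h1.2 halfSignL1 hBV
    have h4 := hexp n
    rw [hmean, zero_smul, sub_zero] at h4
    have h5 : K p * (bvNorm halfSign).toReal ≤ M.toReal := by
      have := ENNReal.toReal_mono hne h2
      rwa [ENNReal.toReal_mul, ENNReal.toReal_ofReal (zero_le_one.trans (hK1 p))] at this
    rw [hnorm] at hup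
    exact (h3 n _ (memBV_opCocycle n p hBV)).trans (h4.trans
      (mul_le_mul_of_nonneg_left (hup.trans h5) (Real.exp_pos _).le))
  -- a column of height `n + 1` violates the decay at time `n`, since `‖ψ‖_BV ≥ 1`
  obtain ⟨n, hn⟩ : ∃ n : ℕ, Real.exp (-lam * n) * M.toReal < 1 := by
    have h1 : Tendsto (fun n : ℕ => Real.exp (-lam * n) * M.toReal) atTop (𝓝 (0 * M.toReal)) := by
      refine Tendsto.mul_const _ (Real.tendsto_exp_atBot.comp ?_)
      exact tendsto_natCast_atTop_atTop.const_mul_atTop_of_neg (by linarith)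
    rw [zero_mul] at h1
    exact (h1.eventually_lt_const one_pos).exists
  obtain ⟨p, hp, hp0, hpi⟩ : ∃ p : Tower, (∀ n : ℕ,
      (bvNorm (opCocycle towerMap towerTransfer n p halfSignL1)).toReal ≤
        Real.exp (-lam * n) * M.toReal) ∧
      p.1.1 0 = n.succPNat ∧ p.1.2 = 0 := by
    by_contra hno
    push Not at hno
    have hnull : towerMeasure δ hδ {p : Tower | p.1.1 0 = n.succPNat ∧ p.1.2 = 0} = 0 :=
      measure_eq_zero_iff_ae_notMem.2 (hdecay.mono fun p hp hm => hno p hp hm.1 hm.2)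
    exact (towerMeasure_bottom_pos δ hδ n.succPNat).ne' hnull
  obtain ⟨⟨ω, i⟩, hi⟩ := p
  obtain rfl : i = 0 := hpi
  have hlt : n < (ω 0 : ℕ) := by
    have : (ω 0 : ℕ) = n + 1 := by
      change ω 0 = n.succPNat at hp0
      rw [hp0, Nat.succPNat_coe]
    omega
  have h6 := hp n
  rw [opCocycle_halfSignL1 hlt, hnorm] at h6
  linarith

/-! ### The quenched variance along the columns -/

theorem birkhoff_obs (n : ℕ) (p : Tower) (x : unitInterval) :
    birkhoff towerMap towerFamily obs n p x =
      ∑ i ∈ Finset.range n, halfSign (mapCocycle towerMap towerFamily i p x) := by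
  simp only [birkhoff, obs_eq]

theorem birkhoff_add {Ω : Type*} (σ : Equiv.Perm Ω) (T : Ω → unitInterval → unitInterval)
    (ψ : Ω → unitInterval → ℝ) (m n : ℕ) (ω : Ω) (x : unitInterval) :
    birkhoff σ T ψ (m + n) ω x =
      birkhoff σ T ψ m ω x + birkhoff σ T ψ n (σ^[m] ω) (mapCocycle σ T m ω x) := by
  simp only [birkhoff, Finset.sum_range_add]
  congr 1
  refine Finset.sum_congr rfl fun i _ => ?_
  rw [mapCocycle_add, ← Function.iterate_add_apply, add_comm i m]
  rfl

theorem memLp_birkhoff_obs (n : ℕ) (p : Tower) :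
    MemLp (birkhoff towerMap towerFamily obs n p) ∞ volume := by
  have e : birkhoff towerMap towerFamily obs n p = fun x =>
      ∑ i ∈ Finset.range n, halfSign (mapCocycle towerMap towerFamily i p x) :=
    funext (birkhoff_obs n p)
  rw [e]
  exact memLp_finsetSum _ fun i _ =>
    (memLp_halfSign ∞).comp_measurePreserving (measurePreserving_mapCocycle i p)

theorem halfSign_comp_iterate_halfDoubling (k : ℕ) :
    halfSign ∘ halfDoubling^[k] =ᵐ[volume] halfSign := by
  induction k with
  | zero => rfl
  | succ k ih =>
    rw [Function.iterate_succ, ← Function.comp_assoc]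
    exact (isTwoBranch_halfDoubling.measurePreserving.quasiMeasurePreserving.ae_eq ih).trans
      halfSign_comp_halfDoubling

/-- Within a column the Birkhoff sums of the observable grow linearly. -/
theorem birkhoff_obs_column {ω : SymbolSeq} {i n : ℕ} (hi : i < (ω 0 : ℕ)) (h : i + n ≤ (ω 0 : ℕ)) :
    birkhoff towerMap towerFamily obs n ⟨(ω, i), hi⟩ =ᵐ[volume] fun x => n * halfSign x := by
  filter_upwards [ae_all_iff.2 halfSign_comp_iterate_halfDoubling] with x hx
  rw [birkhoff_obs, Finset.sum_congr rfl fun j hj => ?_]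
  · rw [Finset.sum_const, Finset.card_range, nsmul_eq_mul]
  · rw [mapCocycle_of_lt hi (by have := Finset.mem_range.1 hj; omega)]
    exact hx j

/-- The observable is uncorrelated with everything that happens after the next visit to the bottom
of the tower. -/
theorem integral_halfSign_mul_return {ω : SymbolSeq} {i k : ℕ} (hi : i < (ω 0 : ℕ))
    (h : i + k + 1 = (ω 0 : ℕ)) {g : unitInterval → ℝ} (hg : MemLp g ∞ volume) :
    ∫ x, halfSign x * g (mapCocycle towerMap towerFamily (k + 1) ⟨(ω, i), hi⟩ x) = 0 := by
  rw [mapCocycle_return hi h]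
  have hmp := isTwoBranch_halfDoubling.measurePreserving.iterate k
  have hG : MemLp (fun x => g (doubling x)) ∞ volume :=
    hg.comp_measurePreserving isTwoBranch_doubling.measurePreserving
  have e : (fun x => halfSign x * g ((doubling ∘ halfDoubling^[k]) x)) =ᵐ[volume]
      fun x => (fun y => halfSign y * g (doubling y)) (halfDoubling^[k] x) := by
    filter_upwards [halfSign_comp_iterate_halfDoubling k] with x hx
    simp only [Function.comp_apply] at hx ⊢
    rw [hx]
  have hmeas : AEStronglyMeasurable (fun y => halfSign y * g (doubling y))
      (Measure.map halfDoubling^[k] volume) := by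
    rw [hmp.map_eq]
    exact measurable_halfSign.aestronglyMeasurable.mul hG.aestronglyMeasurable
  rw [integral_congr_ae e, ← integral_map hmp.aemeasurable hmeas, hmp.map_eq]
  exact integral_halfSign_mul_comp_doubling hg

/-- The second moment of the Birkhoff sums of the observable; it is their variance because the
observable has mean zero. -/
noncomputable def quenchedVariance (n : ℕ) (p : Tower) : ℝ :=
  ∫ x, (birkhoff towerMap towerFamily obs n p x) ^ 2

theorem quenchedVariance_nonneg (n : ℕ) (p : Tower) : 0 ≤ quenchedVariance n p :=
  integral_nonneg fun _ => sq_nonneg _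

/-- Columns are uncorrelated: leaving a column after `k + 1` steps contributes `(k + 1)²` to the
variance, independently of what follows. -/
theorem quenchedVariance_return {ω : SymbolSeq} {i k : ℕ} (hi : i < (ω 0 : ℕ))
    (h : i + k + 1 = (ω 0 : ℕ)) (n : ℕ) :
    quenchedVariance (k + 1 + n) ⟨(ω, i), hi⟩ =
      ((k + 1 : ℕ) : ℝ) ^ 2 + quenchedVariance n ⟨(leftShift ω, 0), PNat.pos _⟩ := by
  set q : Tower := ⟨(leftShift ω, 0), PNat.pos _⟩ with hq
  set U := mapCocycle towerMap towerFamily (k + 1) ⟨(ω, i), hi⟩ with hU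
  have hret : towerMap^[k + 1] ⟨(ω, i), hi⟩ = q := by
    rw [hq, ← iterate_towerMap_return hi, ← h]
    congr 2
    omega
  have hUmp : MeasurePreserving U volume volume := measurePreserving_mapCocycle _ _
  set G := birkhoff towerMap towerFamily obs n q with hG
  have hGm : MemLp G ∞ volume := memLp_birkhoff_obs n q
  have hGU : MemLp (fun x => G (U x)) ∞ volume := hGm.comp_measurePreserving hUmp
  have hG2 : MemLp (fun x => G x ^ 2) ∞ volume := by
    simpa only [pow_two] using hGm.mul' (r := ∞) hGm
  have hGU2 : MemLp (fun x => G (U x) ^ 2) ∞ volume := by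
    simpa only [pow_two] using hGU.mul' (r := ∞) hGU
  have hcross : MemLp (fun x => halfSign x * G (U x)) ∞ volume :=
    hGU.mul' (r := ∞) (memLp_halfSign ∞)
  have e : (fun x => (birkhoff towerMap towerFamily obs (k + 1 + n) ⟨(ω, i), hi⟩ x) ^ 2) =ᵐ[volume]
      fun x => (((k + 1 : ℕ) : ℝ) ^ 2 + 2 * ((k + 1 : ℕ) : ℝ) * (halfSign x * G (U x))) +
        G (U x) ^ 2 := by
    filter_upwards [birkhoff_obs_column hi (by omega : i + (k + 1) ≤ (ω 0 : ℕ))] with x hx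
    rw [birkhoff_add, hret, hx]
    have h1 := halfSign_sq x
    change (((k + 1 : ℕ) : ℝ) * halfSign x + G (U x)) ^ 2 = _
    linear_combination ((k + 1 : ℕ) : ℝ) ^ 2 * h1
  have hi1 : Integrable (fun x => 2 * ((k + 1 : ℕ) : ℝ) * (halfSign x * G (U x))) :=
    (hcross.integrable le_top).const_mul _
  have hi12 : Integrable
      (fun x => ((k + 1 : ℕ) : ℝ) ^ 2 + 2 * ((k + 1 : ℕ) : ℝ) * (halfSign x * G (U x))) :=
    (integrable_const _).add hi1
  have hi2 : Integrable (fun x => G (U x) ^ 2) := hGU2.integrable le_top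
  have h0 : ∫ x, halfSign x * G (U x) = 0 := integral_halfSign_mul_return hi h hGm
  have h2 : ∫ x, G (U x) ^ 2 = ∫ x, G x ^ 2 := by
    have hmeas : AEStronglyMeasurable (fun y => G y ^ 2) (Measure.map U volume) := by
      rw [hUmp.map_eq]
      exact hG2.aestronglyMeasurable
    rw [← integral_map (f := fun y => G y ^ 2) hUmp.aemeasurable hmeas, hUmp.map_eq]
  rw [quenchedVariance, integral_congr_ae e, integral_add hi12 hi2,
    integral_add (integrable_const _) hi1, integral_const_mul, h0, h2, quenchedVariance]
  simp [hG]

/-- Starting at the bottom, the variance is at least the sum of the squared heights of the columns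
that have been completed. -/
theorem sum_sq_le_quenchedVariance_bottom (k : ℕ) (ω : SymbolSeq) {N : ℕ}
    (hN : ∑ j ∈ Finset.range k, (ω (j : ℤ) : ℕ) ≤ N) :
    ∑ j ∈ Finset.range k, ((ω (j : ℤ) : ℕ) : ℝ) ^ 2 ≤
      quenchedVariance N ⟨(ω, 0), PNat.pos _⟩ := by
  induction k generalizing ω N with
  | zero => simpa using quenchedVariance_nonneg _ _
  | succ k ih =>
    have hs : ∀ j : ℕ, ω ((j + 1 : ℕ) : ℤ) = leftShift ω (j : ℤ) := fun j => by
      rw [leftShift_apply]; push_cast; rfl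
    rw [Finset.sum_range_succ'] at hN ⊢
    simp only [hs, Nat.cast_zero] at hN ⊢
    obtain ⟨r, hr⟩ : ∃ r, (ω 0 : ℕ) = r + 1 := ⟨(ω 0 : ℕ) - 1, by have := (ω 0).pos; omega⟩
    obtain ⟨n, rfl⟩ : ∃ n, N = r + 1 + n := ⟨N - (r + 1), by omega⟩
    rw [quenchedVariance_return (PNat.pos _) (by omega), hr, add_comm]
    have := ih (leftShift ω) (N := n) (by omega)
    linarith

/-- From an arbitrary starting level the first, partial column is discarded. -/
theorem sum_sq_le_quenchedVariance (k : ℕ) {ω : SymbolSeq} {i : ℕ} (hi : i < (ω 0 : ℕ)) {N : ℕ}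
    (hN : (ω 0 : ℕ) - i + ∑ j ∈ Finset.range k, (leftShift ω (j : ℤ) : ℕ) ≤ N) :
    ∑ j ∈ Finset.range k, ((leftShift ω (j : ℤ) : ℕ) : ℝ) ^ 2 ≤
      quenchedVariance N ⟨(ω, i), hi⟩ := by
  obtain ⟨r, hr⟩ : ∃ r, i + r + 1 = (ω 0 : ℕ) := ⟨(ω 0 : ℕ) - i - 1, by omega⟩
  obtain ⟨n, rfl⟩ : ∃ n, N = r + 1 + n := ⟨N - (r + 1), by omega⟩
  rw [quenchedVariance_return hi hr]
  have := sum_sq_le_quenchedVariance_bottom k (leftShift ω) (N := n) (by omega)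
  have h2 : (0 : ℝ) ≤ ((r + 1 : ℕ) : ℝ) ^ 2 := sq_nonneg _
  linarith

/-! ### Growth of the sums of squares -/

section Growth

variable (δ : ℝ) (hδ : 0 < δ)

/-- The strong law of large numbers for functions of one symbol. -/
theorem ae_tendsto_average {f : ℕ+ → ℝ}
    (hf : Integrable (fun ω : SymbolSeq => f (ω 0)) (shiftMeasure δ hδ)) :
    ∀ᵐ ω ∂(shiftMeasure δ hδ), Tendsto
      (fun n : ℕ => (∑ j ∈ Finset.range n, f (ω (j : ℤ))) / n) atTop
      (𝓝 (∫ ω, f (ω 0) ∂(shiftMeasure δ hδ))) := by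
  have hfm : Measurable f := measurable_of_countable f
  have hind : ProbabilityTheory.iIndepFun (fun (i : ℤ) (ω : SymbolSeq) => f (ω i))
      (shiftMeasure δ hδ) :=
    ProbabilityTheory.iIndepFun_infinitePi (X := fun _ => f) (fun _ => hfm)
  refine ProbabilityTheory.strong_law_ae_real (fun (j : ℕ) (ω : SymbolSeq) => f (ω (j : ℤ))) hf
    (fun i j hij => hind.indepFun (by exact_mod_cast hij)) fun j => ?_
  refine ProbabilityTheory.IdentDistrib.comp (u := f) (f := fun ω : SymbolSeq => ω (j : ℤ))
    (g := fun ω : SymbolSeq => ω ((0 : ℕ) : ℤ)) ⟨(measurable_pi_apply _).aemeasurable,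
      (measurable_pi_apply _).aemeasurable, ?_⟩ hfm
  exact (Measure.infinitePi_map_eval (fun _ : ℤ => (symbolLaw δ hδ).toMeasure) _).trans
    (Measure.infinitePi_map_eval (fun _ : ℤ => (symbolLaw δ hδ).toMeasure) _).symm

theorem integrable_roof :
    Integrable (fun ω : SymbolSeq => ((ω 0 : ℕ) : ℝ)) (shiftMeasure δ hδ) := by
  have hm : Measurable (fun ω : SymbolSeq => ((ω 0 : ℕ) : ℝ)) :=
    (measurable_of_countable (fun n : ℕ => (n : ℝ))).comp measurable_roof
  refine ⟨hm.aestronglyMeasurable, ?_⟩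
  rw [hasFiniteIntegral_iff_enorm]
  refine lt_of_eq_of_lt (lintegral_congr fun ω => ?_) (meanRoof_ne_top δ hδ).lt_top
  rw [Real.enorm_of_nonneg (Nat.cast_nonneg _), ENNReal.ofReal_natCast]

theorem integrable_truncated (M : ℕ) :
    Integrable (fun ω : SymbolSeq => min (((ω 0 : ℕ) : ℝ) ^ 2) M) (shiftMeasure δ hδ) := by
  have hm : Measurable (fun ω : SymbolSeq => min (((ω 0 : ℕ) : ℝ) ^ 2) M) :=
    (measurable_of_countable (fun n : ℕ => min ((n : ℝ) ^ 2) M)).comp measurable_roof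
  refine Integrable.of_bound hm.aestronglyMeasurable (M : ℝ) (ae_of_all _ fun ω => ?_)
  rw [Real.norm_eq_abs, abs_of_nonneg (by positivity)]
  exact min_le_right _ _

/-- The truncated second moments of the roof function are unbounded, by monotone convergence. -/
theorem exists_lt_integral_truncated (hδ1 : δ ≤ 1) (C : ℝ) :
    ∃ M : ℕ, C < ∫ ω : SymbolSeq, min (((ω 0 : ℕ) : ℝ) ^ 2) M ∂(shiftMeasure δ hδ) := by
  by_contra hno
  push Not at hno
  have h1 : ∀ M : ℕ, ∫⁻ ω : SymbolSeq, min (((ω 0 : ℕ) : ℝ≥0∞) ^ 2) M ∂(shiftMeasure δ hδ) ≤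
      ENNReal.ofReal C := fun M => by
    refine le_trans (le_of_eq ?_) (ENNReal.ofReal_le_ofReal (hno M))
    rw [ofReal_integral_eq_lintegral_ofReal (integrable_truncated δ hδ M)
      (ae_of_all _ fun ω => by positivity)]
    refine lintegral_congr fun ω => ?_
    rw [ENNReal.ofReal_min, ENNReal.ofReal_pow (Nat.cast_nonneg _), ENNReal.ofReal_natCast,
      ENNReal.ofReal_natCast]
  have hsup : ∀ ω : SymbolSeq, ⨆ M : ℕ, min (((ω 0 : ℕ) : ℝ≥0∞) ^ 2) M =
      ((ω 0 : ℕ) : ℝ≥0∞) ^ 2 := fun ω => by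
    rw [← inf_iSup_eq, ENNReal.iSup_natCast, inf_top_eq]
  have h2 := lintegral_roof_sq δ hδ hδ1 0
  have hm : ∀ M : ℕ, Measurable fun ω : SymbolSeq => min (((ω 0 : ℕ) : ℝ≥0∞) ^ 2) M := fun M =>
    (measurable_of_countable (fun n : ℕ => min ((n : ℝ≥0∞) ^ 2) M)).comp measurable_roof
  rw [← lintegral_congr hsup, lintegral_iSup hm
    (fun M M' h ω => min_le_min_left _ (by exact_mod_cast h))] at h2
  have h3 : (⊤ : ℝ≥0∞) ≤ ENNReal.ofReal C := h2 ▸ iSup_le h1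
  exact absurd h3 (not_le.2 ENNReal.ofReal_lt_top)

/-- The averages of the squared heights diverge: compare with the averages of truncated squares,
whose limits are arbitrarily large. -/
theorem ae_tendsto_sum_sq (hδ1 : δ ≤ 1) :
    ∀ᵐ ω ∂(shiftMeasure δ hδ), Tendsto
      (fun n : ℕ => (∑ j ∈ Finset.range n, ((ω (j : ℤ) : ℕ) : ℝ) ^ 2) / n) atTop atTop := by
  have h : ∀ᵐ ω ∂(shiftMeasure δ hδ), ∀ M : ℕ, Tendsto
      (fun n : ℕ => (∑ j ∈ Finset.range n, min (((ω (j : ℤ) : ℕ) : ℝ) ^ 2) M) / n) atTop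
      (𝓝 (∫ ω : SymbolSeq, min (((ω 0 : ℕ) : ℝ) ^ 2) M ∂(shiftMeasure δ hδ))) :=
    ae_all_iff.2 fun M => ae_tendsto_average δ hδ (f := fun k => min (((k : ℕ) : ℝ) ^ 2) M)
      (integrable_truncated δ hδ M)
  filter_upwards [h] with ω hω
  refine tendsto_atTop.2 fun C => ?_
  obtain ⟨M, hM⟩ := exists_lt_integral_truncated δ hδ hδ1 C
  filter_upwards [(hω M).eventually_const_lt hM] with n hn
  refine hn.le.trans ?_
  gcongr
  exact min_le_left _ _

end Growth

/-- If `A` grows faster than linearly and `B` linearly, then `A k` eventually exceeds every multiple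
of `B (k + 1)`. -/
theorem eventually_mul_le_of_average {A B : ℕ → ℝ} {e : ℝ}
    (hA : Tendsto (fun k : ℕ => A k / k) atTop atTop)
    (hB : Tendsto (fun k : ℕ => B k / k) atTop (𝓝 e)) {C : ℝ} (hC : 0 ≤ C) (l : ℝ) :
    ∀ᶠ k : ℕ in atTop, C * (l + B (k + 1)) ≤ A k := by
  have h1 : ∀ᶠ k : ℕ in atTop, B (k + 1) / ((k + 1 : ℕ) : ℝ) < |e| + 1 :=
    (tendsto_add_atTop_iff_nat 1).2 hB |>.eventually_lt_const
      (by linarith [le_abs_self e])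
  have h2 : ∀ᶠ k : ℕ in atTop, 2 * (C * (|e| + 2)) ≤ A k / k := hA.eventually_ge_atTop _
  have h3 : ∀ᶠ k : ℕ in atTop, l ≤ (k : ℝ) := tendsto_natCast_atTop_atTop.eventually_ge_atTop l
  filter_upwards [h1, h2, h3, eventually_ge_atTop 1] with k h1 h2 h3 h4
  have hk : (1 : ℝ) ≤ k := by exact_mod_cast h4
  rw [le_div_iff₀ (by linarith)] at h2
  rw [div_lt_iff₀ (by positivity)] at h1
  push_cast at h1
  have he := abs_nonneg e
  have h5 : l + B (k + 1) ≤ (|e| + 2) * (2 * k) := by nlinarith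
  calc C * (l + B (k + 1)) ≤ C * ((|e| + 2) * (2 * k)) := by gcongr
    _ = 2 * (C * (|e| + 2)) * k := by ring
    _ ≤ A k := h2

/-- The variance at a time between the `k`-th and the `(k + 1)`-st visit to the bottom is at least
the sum of `k` squared heights, while the time is at most the sum of `k + 1` heights; the heights
have finite mean and infinite second moment. -/
theorem ae_tendsto_quenchedVariance (δ : ℝ) (hδ : 0 < δ) (hδ1 : δ ≤ 1) :
    ∀ᵐ p ∂(towerMeasure δ hδ),
      Tendsto (fun n : ℕ => 1 / (n : ℝ) * quenchedVariance n p) atTop atTop := by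
  have hQ : ∀ᵐ ω ∂(shiftMeasure δ hδ),
      Tendsto (fun n : ℕ => (∑ j ∈ Finset.range n, ((leftShift ω (j : ℤ) : ℕ) : ℝ) ^ 2) / n)
        atTop atTop ∧
      Tendsto (fun n : ℕ => (∑ j ∈ Finset.range n, ((leftShift ω (j : ℤ) : ℕ) : ℝ)) / n)
        atTop (𝓝 (∫ ω : SymbolSeq, ((ω 0 : ℕ) : ℝ) ∂(shiftMeasure δ hδ))) :=
    (measurePreserving_leftShift δ hδ).quasiMeasurePreserving.ae
      ((ae_tendsto_sum_sq δ hδ hδ1).and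
        (ae_tendsto_average δ hδ (f := fun k => ((k : ℕ) : ℝ)) (integrable_roof δ hδ)))
  filter_upwards [(quasiMeasurePreserving_tower_fst δ hδ).ae hQ] with p hp
  obtain ⟨⟨ω, i⟩, hi⟩ := p
  dsimp only at hi hp
  refine tendsto_atTop.2 fun C' => ?_
  set C := max C' 0 with hC
  obtain ⟨k₀, hk₀⟩ := eventually_atTop.1 (eventually_mul_le_of_average hp.1 hp.2
    (le_max_right C' 0) (((ω 0 : ℕ) - i : ℕ) : ℝ))
  set R : ℕ → ℕ := fun k => (ω 0 : ℕ) - i + ∑ j ∈ Finset.range k, (leftShift ω (j : ℤ) : ℕ) with hR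
  have hRk : ∀ k, k ≤ R k := fun k => by
    have : ∑ j ∈ Finset.range k, 1 ≤ ∑ j ∈ Finset.range k, (leftShift ω (j : ℤ) : ℕ) :=
      Finset.sum_le_sum fun j _ => (leftShift ω (j : ℤ)).pos
    simp only [Finset.sum_const, Finset.card_range, smul_eq_mul, mul_one] at this
    simp only [hR]
    omega
  filter_upwards [eventually_ge_atTop (max (R k₀) 1)] with N hN
  have hN0 : R k₀ ≤ N := (le_max_left _ _).trans hN
  have hN1 : (0 : ℝ) < N := by exact_mod_cast (le_max_right _ _).trans hN
  -- the number of completed columns by time `N`, not counting the first one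
  set k := Nat.findGreatest (fun k => R k ≤ N) N with hk
  have hkR : R k ≤ N := Nat.findGreatest_spec (P := fun k => R k ≤ N) ((hRk k₀).trans hN0) hN0
  have hk0 : k₀ ≤ k := Nat.le_findGreatest ((hRk k₀).trans hN0) hN0
  have hkN : N < R (k + 1) := by
    by_contra hle
    push Not at hle
    have := Nat.le_findGreatest (P := fun k => R k ≤ N) ((hRk (k + 1)).trans hle) hle
    omega
  have h1 := hk₀ k hk0
  have h2 := sum_sq_le_quenchedVariance k hi hkR
  have h3 : (N : ℝ) ≤ (((ω 0 : ℕ) - i : ℕ) : ℝ) +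
      ∑ j ∈ Finset.range (k + 1), ((leftShift ω (j : ℤ) : ℕ) : ℝ) := by
    have : (N : ℝ) ≤ (R (k + 1) : ℝ) := by exact_mod_cast hkN.le
    simpa [hR] using this
  rw [one_div, ← div_eq_inv_mul, le_div_iff₀ hN1]
  calc C' * N ≤ C * N := by gcongr; exact le_max_left _ _
    _ ≤ C * ((((ω 0 : ℕ) - i : ℕ) : ℝ) +
        ∑ j ∈ Finset.range (k + 1), ((leftShift ω (j : ℤ) : ℕ) : ℝ)) := by
      gcongr
    _ ≤ _ := h1.trans h2

/-! ### The system over the tower -/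

theorem mainTheorem3 (δ : ℝ) (hδ : 0 < δ) (hδ1 : δ ≤ 1) :
    -- the random system
    IsRandomSystem (towerMeasure δ hδ) towerMap towerFamily ∧
    -- the covering time: it is finite, equal to `h(ω) - i`, and not integrable
    (∀ p : Tower, (coveringTimes p).Nonempty ∧ coveringTime p = (p.1.1 0 : ℕ) - p.1.2) ∧
    Measurable coveringTime ∧
    ∫⁻ p, (coveringTime p : ℝ≥0∞) ∂(towerMeasure δ hδ) = ⊤ ∧
    -- the cocycle of transfer operators exists and is good
    ∃ L : Tower → L1I →L[ℝ] L1I, (∀ p, IsTransferOperator (towerFamily p) (L p)) ∧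
      IsGoodCocycle (towerMeasure δ hδ) towerMap L ∧
      -- Lebesgue measure is the unique equivariant family
      IsEquivariantDensity (towerMeasure δ hδ) towerMap L (fun _ => oneL1) ∧
      (∀ v : Tower → L1I, IsEquivariantDensity (towerMeasure δ hδ) towerMap L v →
        ∀ᵐ p ∂(towerMeasure δ hδ), v p = oneL1) ∧
      -- the observable is measurable, in `BV`, and centred
      Measurable (fun q : Tower × unitInterval => obs q.1 q.2) ∧
      (∀ p, MemBV (obs p)) ∧
      (∀ p, ∫ x, obs p x = 0) ∧
      -- the scaling condition fails
      (∀ K : Tower → ℝ, IsAdaptedConstant (towerMeasure δ hδ) towerMap L K →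
        essSup (fun p => ENNReal.ofReal (K p) * bvNorm (obs p)) (towerMeasure δ hδ) = ⊤) ∧
      -- the quenched variances grow faster than linearly
      (∀ᵐ p ∂(towerMeasure δ hδ), Tendsto
        (fun n : ℕ => 1 / (n : ℝ) * ∫ x, (birkhoff towerMap towerFamily obs n p x) ^ 2)
        atTop atTop) ∧
      -- hence no asymptotic variance exists
      ¬ ∃ s : ℝ, ∀ᵐ p ∂(towerMeasure δ hδ), Tendsto
        (fun n : ℕ => 1 / (n : ℝ) * ∫ x, (birkhoff towerMap towerFamily obs n p x) ^ 2)
        atTop (𝓝 s) := by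
  have hvar := ae_tendsto_quenchedVariance δ hδ hδ1
  refine ⟨isRandomSystem_tower δ hδ, fun p => ⟨⟨_, (isLeast_coveringTimes p).1⟩, coveringTime_eq p⟩,
    measurable_coveringTime, lintegral_coveringTime δ hδ hδ1, towerTransfer,
    isTransferOperator_tower, isGoodCocycle_tower δ hδ, isEquivariantDensity_one δ hδ,
    fun v hv => equivariantDensity_eq_one δ hδ hv, ?_, fun p => ?_, fun p => ?_,
    fun K hK => essSup_adaptedConstant δ hδ hK, hvar, ?_⟩
  · simp_rw [obs_eq]
    exact measurable_halfSign.comp measurable_snd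
  · rw [obs_eq]
    exact memBV_halfSign
  · rw [obs_eq]
    exact integral_halfSign
  · rintro ⟨s, hs⟩
    obtain ⟨p, h1, h2⟩ := (hvar.and hs).exists
    exact not_tendsto_nhds_of_tendsto_atTop h1 s h2
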